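/- Let $(\Omega,\mathcal F,\mathbb P)$ be a probability space with a measurable, measure-preserving, ergodic flow $(\theta_t)_{t\in\mathbb R}$, and let $W$ be a two-sided scalar Wiener process with continuous paths, $W_0=0$ and $W_t(\theta_s\omega)=W_{t+s}(\omega)-W_s(\omega)$ for all $s,t\in\mathbb R$, $\omega\in\Omega$. Let $z(\omega)=\int_{-\infty}^0 e^{\tau}\,dW_\tau(\omega)$, understood pathwise as $-\int_{-\infty}^0 e^{\tau}W_\tau(\omega)\,d\tau$ (and as $0$ on the null set where this integral does not converge absolutely), so that $z(\theta_t\omega)$ is the stationary solution of $dz+z\,dt=dW$. Let $A^c\in\mathbb R^{n\times n}$, $A^s\in\mathbb R^{m\times m}$ and let $f^c:\mathbb R^n\times\mathbb R^m\to\mathbb R^n$, $f^s:\mathbb R^n\times\mathbb R^m\to\mathbb R^m$ be $C^1$ with $f^c(0,0)=0$, $f^s(0,0)=0$ and $$|f^{i}(x_1,y_1)-f^{i}(x_2,y_2)|\le L_f\,(|x_1-x_2|+|y_1-y_2|),\qquad i\in\{c,s\},$$ where $L_f\ge 0$. Assume **(H)** there are constants $\beta>\gamma\ge0$ and $K>0$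 with $|e^{A^ct}x|\le Ke^{\gamma|t|}|x|$ for all $t\in\mathbb R$, $x\in\mathbb R^n$, and $|e^{A^st}y|\le Ke^{-\beta t}|y|$ for all $t\ge0$, $y\in\mathbb R^m$. Let $\varepsilon>0$ and let $\gamma<\eta<\beta$ satisfy the gap condition $\frac{KL_f}{\eta-\gamma}+\frac{KL_f}{\beta-\eta}<1$. Consider the random differential equation $$\dot X=A^cX+\varepsilon z(\theta_t\omega)X+F^c(\theta_t\omega,X,Y),\qquad \dot Y=A^sY+\varepsilon z(\theta_t\omega)Y+F^s(\theta_t\omega,X,Y),\tag{1}$$ $$F^{i}(\omega,X,Y)=e^{-\varepsilon z(\omega)}f^{i}\big(e^{\varepsilon z(\omega)}X,\,e^{\varepsilon z(\omega)}Y\big),\qquad i\in\{c,s\},$$ which is obtained from the Stratonovich system $dx=(A^cx+f^c(x,y))\,dt+\varepsilon x\circ dW$, $dy=(A^sy+f^s(x,y))\,dt+\varepsilon y\circ dW$ by the substitution $X=e^{-\varepsilon z(\theta_t\omega)}x$, $Y=e^{-\varepsilon z(\theta_t\omega)}y$. **Theorem.** Equation (1) has unique global solutions, and its solution map is a random dynamical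 system $\phi$ (a measurable cocycle over $\theta$). There is a map $\tilde H^\varepsilon:\Omega\times\mathbb R^n\to\mathbb R^m$ such that: 1. The graphs $M(\omega)=\{(\xi,\tilde H^\varepsilon(\omega,\xi)):\xi\in\mathbb R^n\}$ form a Lipschitz random center manifold of $\phi$. That is, $M$ is a random set (each $M(\omega)$ is nonempty and closed, and $\omega\mapsto\operatorname{dist}(u,M(\omega))$ is measurable for every $u$), $\phi(t,\omega,M(\omega))\subset M(\theta_t\omega)$ for all $t\in\mathbb R$ and $\omega\in\Omega$, $\tilde H^\varepsilon(\omega,0)=0$, $\tilde H^\varepsilon(\cdot,\xi)$ is measurable for every $\xi$, and $\tilde H^\varepsilon(\omega,\cdot)$ is Lipschitz for every $\omega$. 2. $\tilde H^\varepsilon$ is given by the Lyapunov–Perron method: for all $\omega$ and $\xi$ there is exactly one pair of continuous curves $X:\mathbb R\to\mathbb R^n$, $Y:\mathbb R\to\mathbb R^m$ in the weighted space $C_\eta$, that is, with $$\sup_{t\in\mathbb R}e^{-\eta|t|}e^{-\varepsilon\int_0^tz(\theta_r\omega)dr}|X(t)|<\infty,\qquad \sup_{t\in\mathbb R}e^{-\eta|t|}e^{-\varepsilon\int_0^tz(\theta_r\omega)dr}|Y(t)|<\infty,$$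 such that for all $t\in\mathbb R$ (with an absolutely convergent second integral) $$X(t)=e^{A^ct+\varepsilon\int_0^tz(\theta_r\omega)dr}\xi+\int_0^te^{A^c(t-\tau)+\varepsilon\int_\tau^tz(\theta_r\omega)dr}F^c(\theta_\tau\omega,X(\tau),Y(\tau))\,d\tau,$$ $$Y(t)=\int_{-\infty}^te^{A^s(t-\tau)+\varepsilon\int_\tau^tz(\theta_r\omega)dr}F^s(\theta_\tau\omega,X(\tau),Y(\tau))\,d\tau,$$ and $\tilde H^\varepsilon(\omega,\xi)=Y(0)$ for this pair. 3. If moreover $Df^s(0,0)=0$, then the tangency condition $D_\xi\tilde H^\varepsilon(\omega,0)=0$ holds for every $\omega$. -/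

import Mathlib

open MeasureTheory ProbabilityTheory Set Filter Topology

noncomputable section

namespace RandomCenterManifold

/-- The Euclidean space `ℝ^k`. -/
abbrev E (k : ℕ) : Type := EuclideanSpace ℝ (Fin k)

/-- A measurable flow `θ_t` on `Ω` that preserves `P` and is ergodic: every measurable set that is
invariant under the whole flow has probability zero or one. -/
structure IsErgodicFlow {Ω : Type*} [MeasurableSpace Ω] (P : Measure Ω) (θ : ℝ → Ω → Ω) :
    Prop where
  measurable : Measurable fun p : ℝ × Ω => θ p.1 p.2
  map_zero : ∀ ω, θ 0 ω = ω
  map_add : ∀ s t ω, θ (s + t) ω = θ s (θ t ω)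
  measurePreserving : ∀ t, MeasurePreserving (θ t) P P
  ergodic : ∀ s : Set Ω, MeasurableSet s → (∀ t, θ t ⁻¹' s = s) → P s = 0 ∨ P s = 1

/-- A two-sided scalar Wiener process `W_t`, `t ∈ ℝ`, with continuous paths, on which the flow `θ`
acts as the Wiener shift: `W_t(θ_s ω) = W_{t+s}(ω) - W_s(ω)`. -/
structure IsTwoSidedWiener {Ω : Type*} [MeasurableSpace Ω] (P : Measure Ω) (θ : ℝ → Ω → Ω)
    (W : ℝ → Ω → ℝ) : Prop where
  measurable : ∀ t, Measurable (W t)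
  continuous : ∀ ω, Continuous fun t => W t ω
  zero : ∀ ω, W 0 ω = 0
  indep_increments : HasIndepIncrements W P
  gaussian_increments : ∀ s t, P.map (fun ω => W t ω - W s ω) = gaussianReal 0 (Real.nnabs (t - s))
  shift : ∀ s t ω, W t (θ s ω) = W (t + s) ω - W s ω

/-- The Ornstein–Uhlenbeck variable `z(ω) = ∫_{-∞}^0 e^τ dW_τ(ω)`. The integrand is smooth, so that
the Wiener integral is the pathwise (improper) Stieltjes integral, which integration by parts
turns into `-∫_{-∞}^0 e^τ W_τ(ω) dτ`. This integral converges almost surely and `z(θ_t ω)` solves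
`dz + z dt = dW`; see `ae_integrableOn_exp_mul` and `ouVar_equation`. -/
def ouVar {Ω : Type*} (W : ℝ → Ω → ℝ) (ω : Ω) : ℝ :=
  -∫ τ in Iic (0 : ℝ), Real.exp τ * W τ ω

/-- Almost surely the integral that defines `ouVar` converges. -/
theorem ae_integrableOn_exp_mul {Ω : Type*} [MeasurableSpace Ω] {P : Measure Ω}
    [IsProbabilityMeasure P] {θ : ℝ → Ω → Ω} {W : ℝ → Ω → ℝ} (hW : IsTwoSidedWiener P θ W) :
    ∀ᵐ ω ∂P, IntegrableOn (fun τ => Real.exp τ * W τ ω) (Iic 0) := by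
  have hmeas : Measurable fun p : Ω × ℝ => W p.2 p.1 :=
    (measurable_uncurry_of_continuous_of_measurable (u := W)
      hW.continuous hW.measurable).comp measurable_swap
  have hmeas' : Measurable fun p : Ω × ℝ => Real.exp p.2 * W p.2 p.1 :=
    (Real.measurable_exp.comp measurable_snd).mul hmeas
  have hmap : ∀ τ, P.map (W τ) = gaussianReal 0 (Real.nnabs τ) := fun τ => by
    simpa [hW.zero] using hW.gaussian_increments 0 τ
  have hsq : ∀ τ, Integrable (fun ω => (W τ ω) ^ 2) P ∧ ∫ ω, (W τ ω) ^ 2 ∂P = |τ| := fun τ => by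
    have h2 : MemLp id 2 (P.map (W τ)) := by
      rw [hmap]; exact memLp_id_gaussianReal 2
    have h3 : MemLp (W τ) 2 P := by
      simpa using h2.comp_of_map (hW.measurable τ).aemeasurable
    refine ⟨h3.integrable_sq, ?_⟩
    have hmean : ∫ ω, W τ ω ∂P = 0 := by
      have := integral_map (μ := P) (hW.measurable τ).aemeasurable
        (f := fun x : ℝ => x) aestronglyMeasurable_id
      rw [← this, hmap]; exact integral_id_gaussianReal
    have hvar : Var[W τ; P] = |τ| := by
      have := variance_map (μ := P) (X := id) (Y := W τ) aemeasurable_id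
        (hW.measurable τ).aemeasurable
      rw [hmap, variance_id_gaussianReal] at this
      simpa using this.symm
    rw [variance_of_integral_eq_zero (hW.measurable τ).aemeasurable hmean] at hvar
    exact hvar
  have hprod : Integrable (fun p : Ω × ℝ => Real.exp p.2 * W p.2 p.1)
      (P.prod (volume.restrict (Iic 0))) := by
    rw [integrable_prod_iff' hmeas'.aestronglyMeasurable]
    have hb : ∀ x : ℝ, |x| ≤ 1 + x ^ 2 := fun x => by
      have := sq_abs x; nlinarith [sq_nonneg (|x| - 1), abs_nonneg x]
    have hint : ∀ τ, Integrable (W τ) P := fun τ =>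
      ((integrable_const (1 : ℝ)).add (hsq τ).1).mono' (hW.measurable τ).aestronglyMeasurable
        (ae_of_all _ fun ω => by simpa using hb (W τ ω))
    refine ⟨ae_of_all _ fun τ => (hint τ).const_mul (Real.exp τ), ?_⟩
    have hdom : IntegrableOn (fun τ : ℝ => Real.exp τ + 2 * Real.exp ((1 / 2) * τ)) (Iic 0) :=
      (integrableOn_exp_Iic 0).add
        ((integrableOn_exp_mul_Iic (by norm_num : (0 : ℝ) < 1 / 2) 0).const_mul 2)
    refine Integrable.mono' hdom ?_ ?_
    · exact (hmeas'.norm.stronglyMeasurable.integral_prod_left').aestronglyMeasurable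
    · refine (ae_restrict_iff' measurableSet_Iic).2 (ae_of_all _ fun τ hτ => ?_)
      have hτ' : τ ≤ 0 := hτ
      have h1 : ∫ ω, ‖Real.exp τ * W τ ω‖ ∂P ≤ Real.exp τ * (1 + |τ|) := by
        have : ∫ ω, (1 + (W τ ω) ^ 2) ∂P = 1 + |τ| := by
          rw [integral_add (integrable_const _) (hsq τ).1, (hsq τ).2]; simp
        rw [← this, ← integral_const_mul]
        refine integral_mono ((hint τ).const_mul _).norm
          (((integrable_const (1 : ℝ)).add (hsq τ).1).const_mul _) fun ω => ?_
        simp only [norm_mul, Real.norm_eq_abs, Real.abs_exp]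
        exact mul_le_mul_of_nonneg_left (hb _) (Real.exp_pos _).le
      have h0 : 0 ≤ ∫ ω, ‖Real.exp τ * W τ ω‖ ∂P := integral_nonneg fun _ => norm_nonneg _
      rw [Real.norm_of_nonneg h0]
      refine h1.trans ?_
      have h2 : |τ| ≤ 2 * Real.exp (-(1 / 2) * τ) := by
        rw [abs_of_nonpos hτ']; linarith [Real.add_one_le_exp (-(1 / 2) * τ)]
      have h3 : Real.exp τ * Real.exp (-(1 / 2) * τ) = Real.exp ((1 / 2) * τ) := by
        rw [← Real.exp_add]; ring_nf
      nlinarith [Real.exp_pos τ]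
  exact hprod.prod_right_ae

/-- Where the defining integral converges, `z(θ_t ω)` solves `dz + z dt = dW`. -/
theorem ouVar_equation {Ω : Type*} [MeasurableSpace Ω] {P : Measure Ω} {θ : ℝ → Ω → Ω}
    {W : ℝ → Ω → ℝ} (hW : IsTwoSidedWiener P θ W) (ω : Ω)
    (hω : IntegrableOn (fun τ => Real.exp τ * W τ ω) (Iic 0)) (t : ℝ) :
    ouVar W (θ t ω) - ouVar W ω + ∫ s in (0 : ℝ)..t, ouVar W (θ s ω) = W t ω := by
  have hc : Continuous fun τ => Real.exp τ * W τ ω :=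
    Real.continuous_exp.mul (hW.continuous ω)
  set G : ℝ → ℝ := fun t => (∫ s in Iic (0 : ℝ), Real.exp s * W s ω) +
    ∫ s in (0 : ℝ)..t, Real.exp s * W s ω with hG
  have hI : ∀ t, IntegrableOn (fun τ => Real.exp τ * W τ ω) (Iic t) := fun t => by
    refine IntegrableOn.mono_set (hω.union (hc.integrableOn_Icc (a := 0) (b := t))) fun x hx => ?_
    rcases le_total x 0 with h | h
    · exact Or.inl h
    · exact Or.inr ⟨h, hx⟩
  have hGt : ∀ t, ∫ s in Iic t, Real.exp s * W s ω = G t := fun t => by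
    have := intervalIntegral.integral_Iic_sub_Iic (hI 0) (hI t)
    simp only [hG]; linarith
  have hz : ∀ t, ouVar W (θ t ω) = W t ω - Real.exp (-t) * G t := fun t => by
    have hemb := measurableEmbedding_addRight t
    have hmp := measurePreserving_add_right (volume : Measure ℝ) t
    have hpre : (fun x : ℝ => x + t) ⁻¹' Iic t = Iic 0 := by ext x; simp
    have hfun : ∀ τ, Real.exp (-t) * (Real.exp (τ + t) * W (τ + t) ω) =
        Real.exp τ * W (τ + t) ω := fun τ => by
      rw [← mul_assoc, ← Real.exp_add]; ring_nf
    have hshift : ∫ τ in Iic (0 : ℝ), Real.exp τ * W (τ + t) ω = Real.exp (-t) * G t := by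
      rw [← hGt, ← integral_const_mul, ← hmp.setIntegral_preimage_emb hemb _ (Iic t), hpre]
      simp_rw [hfun]
    have hshiftI : IntegrableOn (fun τ => Real.exp τ * W (τ + t) ω) (Iic 0) := by
      have := ((hmp.integrableOn_comp_preimage hemb).2 (hI t)).const_mul (Real.exp (-t))
      rw [hpre] at this
      simp only [Function.comp_def, hfun] at this
      exact this
    have hexp : IntegrableOn (fun τ : ℝ => Real.exp τ * W t ω) (Iic 0) :=
      (integrableOn_exp_Iic 0).mul_const _
    simp only [ouVar, hW.shift, mul_sub]
    rw [integral_sub hshiftI hexp, hshift, integral_mul_const, integral_exp_Iic_zero]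
    ring
  have hder : ∀ s, HasDerivAt (fun s => Real.exp (-s) * G s) (W s ω - Real.exp (-s) * G s) s := by
    intro s
    have h1 : HasDerivAt G (Real.exp s * W s ω) s :=
      (intervalIntegral.integral_hasDerivAt_right (hc.intervalIntegrable _ _)
        (hc.stronglyMeasurableAtFilter _ _) hc.continuousAt).const_add _
    have h2 : HasDerivAt (fun s : ℝ => Real.exp (-s)) (-Real.exp (-s)) s := by
      simpa using (hasDerivAt_neg s).exp
    refine (h2.mul h1).congr_deriv ?_
    have : Real.exp (-s) * Real.exp s = 1 := by rw [← Real.exp_add]; simp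
    linear_combination (W s ω) * this
  have hGc : Continuous fun s => Real.exp (-s) * G s :=
    continuous_iff_continuousAt.2 fun s => (hder s).continuousAt
  have hint := intervalIntegral.integral_eq_sub_of_hasDerivAt (a := 0) (b := t)
    (fun s _ => hder s) (((hW.continuous ω).sub hGc).intervalIntegrable _ _)
  have h0 : ouVar W ω = -G 0 := by simp [ouVar, hG]
  simp_rw [hz]
  rw [hint, h0]
  simp

/-- The rescaled nonlinearity `u ↦ e^{-c} f(e^c u)`. -/
def rescale {n m k : ℕ} (f : E n × E m → E k) (c : ℝ) (u : E n × E m) : E k :=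
  Real.exp (-c) • f (Real.exp c • u)

/-- The right-hand side of the random differential equation
`X' = A^c X + ε z(θ_t ω) X + F^c(θ_t ω, X, Y)`, `Y' = A^s Y + ε z(θ_t ω) Y + F^s(θ_t ω, X, Y)`
with `F(θ_t ω, X, Y) = e^{-ε z(θ_t ω)} f(e^{ε z(θ_t ω)} X, e^{ε z(θ_t ω)} Y)`.
The diagonal matrices `z_1`, `z_2` have the one scalar process `z` on their diagonals, so they act
as multiplication by `z`. -/
def field {Ω : Type*} {n m : ℕ} (θ : ℝ → Ω → Ω) (z : Ω → ℝ) (ε : ℝ)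
    (Ac : E n →L[ℝ] E n) (As : E m →L[ℝ] E m) (fc : E n × E m → E n) (fs : E n × E m → E m)
    (ω : Ω) (t : ℝ) (u : E n × E m) : E n × E m :=
  (Ac u.1 + (ε * z (θ t ω)) • u.1 + rescale fc (ε * z (θ t ω)) u,
   As u.2 + (ε * z (θ t ω)) • u.2 + rescale fs (ε * z (θ t ω)) u)

/-- A random dynamical system over the flow `θ`: a measurable cocycle. -/
structure IsRDS {Ω V : Type*} [MeasurableSpace Ω] [MeasurableSpace V] (θ : ℝ → Ω → Ω)
    (φ : ℝ → Ω → V → V) : Prop where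
  measurable : Measurable fun p : ℝ × Ω × V => φ p.1 p.2.1 p.2.2
  map_zero : ∀ ω u, φ 0 ω u = u
  cocycle : ∀ t s ω u, φ (t + s) ω u = φ t (θ s ω) (φ s ω u)

/-- `φ` is the solution map of the random differential equation `u' = G(ω, t, u)`: the global
solutions for `ω` are exactly the curves `t ↦ φ(t, ω, u(0))`. -/
def IsSolutionMap {Ω V : Type*} [NormedAddCommGroup V] [NormedSpace ℝ V]
    (G : Ω → ℝ → V → V) (φ : ℝ → Ω → V → V) : Prop :=
  ∀ ω (u : ℝ → V), (∀ t, HasDerivAt u (G ω t (u t)) t) ↔ ∀ t, u t = φ t ω (u 0)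

/-- A random set: nonempty closed sets `M(ω)` whose distance to every point is measurable. -/
structure IsRandomSet {Ω V : Type*} [MeasurableSpace Ω] [PseudoMetricSpace V]
    (M : Ω → Set V) : Prop where
  nonempty : ∀ ω, (M ω).Nonempty
  isClosed : ∀ ω, IsClosed (M ω)
  measurable_infDist : ∀ x, Measurable fun ω => Metric.infDist x (M ω)

/-- The graph `{(ξ, h(ξ))}` over the center space `ℝ^n`. -/
def graph {n m : ℕ} (h : E n → E m) : Set (E n × E m) := {p | p.2 = h p.1}

/-- The graphs `M(ω)` of `h(ω, ·)` form a Lipschitz random center manifold of the random dynamical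
system `φ`; the center space is `ℝ^n × {0}`, with complement `{0} × ℝ^m`. -/
structure IsLipschitzCenterManifold {Ω : Type*} [MeasurableSpace Ω] {n m : ℕ} (θ : ℝ → Ω → Ω)
    (φ : ℝ → Ω → E n × E m → E n × E m) (h : Ω → E n → E m) : Prop where
  randomSet : IsRandomSet fun ω => graph (h ω)
  invariant : ∀ t ω, φ t ω '' graph (h ω) ⊆ graph (h (θ t ω))
  map_zero : ∀ ω, h ω 0 = 0
  measurable : ∀ v, Measurable fun ω => h ω v
  lipschitz : ∀ ω, ∃ C, LipschitzWith C (h ω)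

/-- The weighted space of continuous curves with
`sup_{t ∈ ℝ} e^{-η|t|} e^{-ε ∫_0^t z(θ_r ω) dr} |x(t)| < ∞`. -/
def MemWeighted {Ω : Type*} {k : ℕ} (θ : ℝ → Ω → Ω) (z : Ω → ℝ) (ε η : ℝ) (ω : Ω)
    (x : ℝ → E k) : Prop :=
  Continuous x ∧ BddAbove (range fun t : ℝ =>
    ‖(Real.exp (-η * |t|) * Real.exp (-ε * ∫ r in (0 : ℝ)..t, z (θ r ω))) • x t‖)

/-- The linear propagator `e^{A (t - τ) + ε ∫_τ^t z(θ_r ω) dr}`. -/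
def propagator {Ω : Type*} {k : ℕ} (θ : ℝ → Ω → Ω) (z : Ω → ℝ) (ε : ℝ) (A : E k →L[ℝ] E k)
    (ω : Ω) (τ t : ℝ) : E k →L[ℝ] E k :=
  Real.exp (ε * ∫ r in τ..t, z (θ r ω)) • NormedSpace.exp ((t - τ) • A)

/-- The pair of curves `(X, Y)` lies in the weighted space and solves the Lyapunov–Perron system
with initial center coordinate `ξ`. -/
structure IsLyapunovPerronSolution {Ω : Type*} {n m : ℕ} (θ : ℝ → Ω → Ω) (z : Ω → ℝ) (ε η : ℝ)
    (Ac : E n →L[ℝ] E n) (As : E m →L[ℝ] E m) (fc : E n × E m → E n) (fs : E n × E m → E m)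
    (ω : Ω) (ξ : E n) (X : ℝ → E n) (Y : ℝ → E m) : Prop where
  memX : MemWeighted θ z ε η ω X
  memY : MemWeighted θ z ε η ω Y
  eqX : ∀ t, X t = propagator θ z ε Ac ω 0 t ξ +
    ∫ τ in (0 : ℝ)..t, propagator θ z ε Ac ω τ t (rescale fc (ε * z (θ τ ω)) (X τ, Y τ))
  integrableY : ∀ t, IntegrableOn
    (fun τ => propagator θ z ε As ω τ t (rescale fs (ε * z (θ τ ω)) (X τ, Y τ))) (Iic t)
  eqY : ∀ t, Y t =
    ∫ τ in Iic t, propagator θ z ε As ω τ t (rescale fs (ε * z (θ τ ω)) (X τ, Y τ))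

end RandomCenterManifold

end

/-! Everything is pathwise. The only probabilistic input is a `z` that is measurable and continuous
along every orbit of the flow (`measurable_ouVar`, `continuous_ouVar_flow`); no exceptional null set
remains.

For fixed `ω` the Lyapunov–Perron system is a fixed point equation `u = p + ∫ h(t, τ, u(τ)) dτ`. The
weight `e^{η|t| + ε∫_0^t z}` removes the randomness from the estimates: the factor `e^{ε∫_τ^t z}` of
the propagator carries the weight from `τ` to `t` (`exp_integral_mul_expWeight`), and rescaling `f`
by `e^{±εz}` preserves its Lipschitz constant (`norm_rescale_sub_le`). What remains is the
deterministic trichotomy estimate. The center integral costs `KL/(η-γ)`, the stable one `KL/(β-η)`,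
so the gap condition makes the operator a contraction whose constant does not depend on `ω`.

Banach's theorem in a function space for each `ω` would say nothing about measurability in `ω`.
Instead `exists_fixedPoint` runs Picard iteration with the parameter carried along: the iterates are
jointly measurable, hence so is their limit. Its companion `sumNorm_fixedPoint_sub_le` gives
uniqueness and Lipschitz dependence on the inhomogeneity. The same two results, with a larger
exponent in the weight, yield the global solution map, the linear part being treated there as a
Lipschitz perturbation.

With `H(ω, ξ) = Y(0)`, invariance follows because a time shift of a Lyapunov–Perron solution is one
for the shifted `ω` (`shift`), while the solution itself is an orbit of `φ`. Tangency is dominated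
convergence applied to `‖Y(0)‖ / ‖ξ‖`, starting from the bound of the solution by a multiple of
`‖ξ‖` times the weight. -/

noncomputable section

namespace RandomCenterManifold

/-! ### Weighted fixed points with a measurable parameter -/

section WeightedFixedPoint

variable {α X Y : Type*} [NormedAddCommGroup X] [NormedAddCommGroup Y]

/-- The sum norm on a product. -/
def sumNorm (u : X × Y) : ℝ := ‖u.1‖ + ‖u.2‖

theorem sumNorm_nonneg (u : X × Y) : 0 ≤ sumNorm u := by unfold sumNorm; positivity

@[simp] theorem sumNorm_zero : sumNorm (0 : X × Y) = 0 := by simp [sumNorm]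

theorem sumNorm_add_le (u v : X × Y) : sumNorm (u + v) ≤ sumNorm u + sumNorm v := by
  have h1 := norm_add_le u.1 v.1
  have h2 := norm_add_le u.2 v.2
  simp only [sumNorm, Prod.fst_add, Prod.snd_add]; linarith

theorem sumNorm_sub_le (u v : X × Y) : sumNorm (u - v) ≤ sumNorm u + sumNorm v := by
  have h1 := norm_sub_le u.1 v.1
  have h2 := norm_sub_le u.2 v.2
  simp only [sumNorm, Prod.fst_sub, Prod.snd_sub]; linarith

theorem norm_le_sumNorm (u : X × Y) : ‖u‖ ≤ sumNorm u := by
  rw [Prod.norm_def]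
  exact max_le (le_add_of_nonneg_right (norm_nonneg _)) (le_add_of_nonneg_left (norm_nonneg _))

theorem sumNorm_le_two_mul_norm (u : X × Y) : sumNorm u ≤ 2 * ‖u‖ := by
  have h1 := norm_fst_le u
  have h2 := norm_snd_le u
  unfold sumNorm; linarith

theorem continuous_sumNorm : Continuous (sumNorm : X × Y → ℝ) := by
  unfold sumNorm; fun_prop

theorem sumNorm_integral_le [NormedSpace ℝ X] [NormedSpace ℝ Y] [CompleteSpace X]
    [CompleteSpace Y] {β : Type*} [MeasurableSpace β] {μ : Measure β} {f : β → X × Y}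
    (hf : Integrable f μ) : sumNorm (∫ x, f x ∂μ) ≤ ∫ x, sumNorm (f x) ∂μ := by
  unfold sumNorm
  rw [fst_integral hf, snd_integral hf, integral_add hf.fst.norm hf.snd.norm]
  exact add_le_add (norm_integral_le_integral_norm _) (norm_integral_le_integral_norm _)

variable [MeasurableSpace α] [MeasurableSpace X] [MeasurableSpace Y]

/-- A family of integral operators `u ↦ ∫ h(a, t, τ, u(τ)) dτ` that contracts by the factor `κ`
the curves of growth at most `w`. -/
structure IsContractiveKernel (h : α → ℝ → ℝ → X × Y → X × Y) (w : α → ℝ → ℝ)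
    (M : ℝ → ℝ → ℝ) (κ : ℝ) : Prop where
  measurable : Measurable fun q : (α × ℝ) × ℝ × X × Y => h q.1.1 q.1.2 q.2.1 q.2.2
  weight_pos : ∀ a t, 0 < w a t
  map_zero : ∀ a t τ, h a t τ 0 = 0
  lipschitz : ∀ a t τ u v,
    sumNorm (h a t τ u - h a t τ v) * w a τ ≤ w a t * M t τ * sumNorm (u - v)
  nonneg : ∀ t τ, 0 ≤ M t τ
  integrable : ∀ t, Integrable (M t)
  integral_le : ∀ t, ∫ τ, M t τ ≤ κ
  lt_one : κ < 1

variable {h : α → ℝ → ℝ → X × Y → X × Y} {w : α → ℝ → ℝ} {M : ℝ → ℝ → ℝ} {κ : ℝ}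

namespace IsContractiveKernel

theorem sumNorm_sub_le (hh : IsContractiveKernel h w M κ) {a : α} {t τ : ℝ} {u v : X × Y} {D : ℝ}
    (huv : sumNorm (u - v) ≤ D * w a τ) :
    sumNorm (h a t τ u - h a t τ v) ≤ w a t * D * M t τ := by
  have h1 := hh.lipschitz a t τ u v
  have h2 : w a t * M t τ * sumNorm (u - v) ≤ w a t * M t τ * (D * w a τ) :=
    mul_le_mul_of_nonneg_left huv (mul_nonneg (hh.weight_pos a t).le (hh.nonneg t τ))
  refine le_of_mul_le_mul_right ?_ (hh.weight_pos a τ)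
  linarith

theorem sumNorm_le (hh : IsContractiveKernel h w M κ) {a : α} {t τ : ℝ} {u : X × Y} {D : ℝ}
    (hu : sumNorm u ≤ D * w a τ) : sumNorm (h a t τ u) ≤ w a t * D * M t τ := by
  have := hh.sumNorm_sub_le (a := a) (t := t) (τ := τ) (u := u) (v := 0) (D := D) (by simpa using hu)
  simpa [hh.map_zero] using this

/-- Needed to pass to the limit under the integral along the Picard iterates. The factor 2 compares
the sum norm with the maximum norm of the product. -/
theorem continuous_right (hh : IsContractiveKernel h w M κ) (a : α) (t τ : ℝ) :
    Continuous (h a t τ) := by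
  have hw := hh.weight_pos a τ
  refine (LipschitzWith.of_dist_le_mul
    (K := Real.toNNReal (w a t * M t τ / w a τ * 2)) fun u v => ?_).continuous
  have hn : 0 ≤ w a t * M t τ / w a τ :=
    div_nonneg (mul_nonneg (hh.weight_pos a t).le (hh.nonneg t τ)) hw.le
  rw [Real.coe_toNNReal _ (by positivity), dist_eq_norm, dist_eq_norm]
  refine (norm_le_sumNorm _).trans ?_
  have h1 := hh.lipschitz a t τ u v
  rw [← le_div_iff₀ hw] at h1
  refine h1.trans ?_
  rw [mul_div_right_comm, mul_assoc]
  exact mul_le_mul_of_nonneg_left (sumNorm_le_two_mul_norm _) hn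

theorem measurable_section (hh : IsContractiveKernel h w M κ) (a : α) (t : ℝ) {u : ℝ → X × Y}
    (hu : Measurable u) : Measurable fun τ => h a t τ (u τ) :=
  hh.measurable.comp ((measurable_const (a := (a, t))).prodMk (measurable_id.prodMk hu))

variable [BorelSpace X] [SecondCountableTopology X] [BorelSpace Y] [SecondCountableTopology Y]

theorem integrable_comp (hh : IsContractiveKernel h w M κ) {a : α} {u : ℝ → X × Y}
    (hu : Measurable u) {C : ℝ} (hC : ∀ t, sumNorm (u t) ≤ C * w a t) (t : ℝ) :
    Integrable fun τ => h a t τ (u τ) :=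
  ((hh.integrable t).const_mul (w a t * C)).mono'
    (hh.measurable_section a t hu).aestronglyMeasurable
    (ae_of_all _ fun τ => (norm_le_sumNorm _).trans (hh.sumNorm_le (hC τ)))

variable [NormedSpace ℝ X] [NormedSpace ℝ Y]

/-- The Picard iterates of `u ↦ p + ∫ h(·, τ, u(τ)) dτ`. -/
def iterate (h : α → ℝ → ℝ → X × Y → X × Y) (p : α → ℝ → X × Y) : ℕ → α → ℝ → X × Y
  | 0 => fun _ _ => 0
  | k + 1 => fun a t => p a t + ∫ τ, h a t τ (iterate h p k a τ)

/-- Integrating out `τ` preserves joint measurability in the parameter and `t`, so it passes from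
each iterate to the next. -/
theorem measurable_iterate (hh : IsContractiveKernel h w M κ) {p : α → ℝ → X × Y}
    (hp : Measurable (Function.uncurry p)) (k : ℕ) :
    Measurable (Function.uncurry (iterate h p k)) := by
  induction k with
  | zero => exact measurable_const
  | succ k ih =>
    have h1 : Measurable fun q : (α × ℝ) × ℝ => h q.1.1 q.1.2 q.2 (iterate h p k q.1.1 q.2) :=
      hh.measurable.comp (measurable_fst.prodMk (measurable_snd.prodMk
        (ih.comp ((measurable_fst.comp measurable_fst).prodMk measurable_snd))))
    exact hp.add (h1.stronglyMeasurable.integral_prod_right' (ν := volume)).measurable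

variable [CompleteSpace X] [CompleteSpace Y]

/-- The contraction estimate. The bounds by `C` and `C'` serve only for integrability and do not
enter the result. -/
theorem sumNorm_integral_sub_le (hh : IsContractiveKernel h w M κ) {a : α} {u v : ℝ → X × Y}
    (hu : Measurable u) (hv : Measurable v) {C C' D : ℝ} (hC : ∀ t, sumNorm (u t) ≤ C * w a t)
    (hC' : ∀ t, sumNorm (v t) ≤ C' * w a t) (hD : ∀ t, sumNorm (u t - v t) ≤ D * w a t) (t : ℝ) :
    sumNorm ((∫ τ, h a t τ (u τ)) - ∫ τ, h a t τ (v τ)) ≤ κ * D * w a t := by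
  have hD0 : 0 ≤ D := by
    have := (sumNorm_nonneg _).trans (hD t)
    exact nonneg_of_mul_nonneg_left this (hh.weight_pos a t)
  have hi := (hh.integrable_comp hu hC t).sub (hh.integrable_comp hv hC' t)
  rw [← integral_sub (hh.integrable_comp hu hC t) (hh.integrable_comp hv hC' t)]
  calc sumNorm (∫ τ, (h a t τ (u τ) - h a t τ (v τ)))
      ≤ ∫ τ, sumNorm (h a t τ (u τ) - h a t τ (v τ)) := sumNorm_integral_le hi
    _ ≤ ∫ τ, w a t * D * M t τ := by
        refine integral_mono_of_nonneg (ae_of_all _ fun _ => sumNorm_nonneg _)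
          ((hh.integrable t).const_mul _) (ae_of_all _ fun τ => hh.sumNorm_sub_le (hD τ))
    _ = w a t * D * ∫ τ, M t τ := integral_const_mul _ _
    _ ≤ w a t * D * κ := mul_le_mul_of_nonneg_left (hh.integral_le t)
        (mul_nonneg (hh.weight_pos a t).le hD0)
    _ = κ * D * w a t := by ring

theorem sumNorm_integral_le (hh : IsContractiveKernel h w M κ) {a : α} {u : ℝ → X × Y}
    (hu : Measurable u) {C : ℝ} (hC : ∀ t, sumNorm (u t) ≤ C * w a t) (t : ℝ) :
    sumNorm (∫ τ, h a t τ (u τ)) ≤ κ * C * w a t := by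
  have hC0 : 0 ≤ C :=
    nonneg_of_mul_nonneg_left ((sumNorm_nonneg _).trans (hC t)) (hh.weight_pos a t)
  have := hh.sumNorm_integral_sub_le (v := fun _ => 0) (C' := 0) (D := C) hu measurable_const hC
    (fun t => by simp) (fun t => by simpa using hC t) t
  simpa [hh.map_zero] using this

/-- Solutions of the fixed point equation depend on the inhomogeneity in a Lipschitz way. -/
theorem sumNorm_fixedPoint_sub_le (hh : IsContractiveKernel h w M κ) {a : α}
    {u v p q : ℝ → X × Y} (hu : Measurable u) (hv : Measurable v) {C C' D : ℝ}
    (hC : ∀ t, sumNorm (u t) ≤ C * w a t) (hC' : ∀ t, sumNorm (v t) ≤ C' * w a t)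
    (hup : ∀ t, u t = p t + ∫ τ, h a t τ (u τ)) (hvq : ∀ t, v t = q t + ∫ τ, h a t τ (v τ))
    (hD : ∀ t, sumNorm (p t - q t) ≤ D * w a t) (t : ℝ) :
    sumNorm (u t - v t) ≤ D / (1 - κ) * w a t := by
  -- The weighted distance of `u` and `v`. It is finite by the growth bounds, so `S ≤ D + κ S` may
  -- be solved for `S`.
  set S : ℝ := ⨆ t, sumNorm (u t - v t) / w a t with hS
  have hbdd : BddAbove (range fun t => sumNorm (u t - v t) / w a t) := by
    refine ⟨C + C', ?_⟩
    rintro _ ⟨s, rfl⟩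
    simp only
    rw [div_le_iff₀ (hh.weight_pos a s), add_mul]
    exact (RandomCenterManifold.sumNorm_sub_le _ _).trans (add_le_add (hC s) (hC' s))
  have hle : ∀ s, sumNorm (u s - v s) ≤ S * w a s := fun s => by
    rw [← div_le_iff₀ (hh.weight_pos a s)]
    exact le_ciSup hbdd s
  have hSle : S ≤ D + κ * S := by
    refine ciSup_le fun s => ?_
    rw [div_le_iff₀ (hh.weight_pos a s), add_mul]
    have hsplit : u s - v s = (p s - q s) + ((∫ τ, h a s τ (u τ)) - ∫ τ, h a s τ (v τ)) := by
      rw [hup s, hvq s]; abel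
    rw [hsplit]
    exact (sumNorm_add_le _ _).trans
      (add_le_add (hD s) (hh.sumNorm_integral_sub_le hu hv hC hC' hle s))
  have h1 : 0 < 1 - κ := sub_pos.2 hh.lt_one
  have : S ≤ D / (1 - κ) := by rw [le_div_iff₀ h1]; linarith
  exact (hle t).trans (mul_le_mul_of_nonneg_right this (hh.weight_pos a t).le)

/-- The Picard iterates start at zero, stay in a fixed weighted ball and converge geometrically at
each `t`. Pointwise limits keep joint measurability, and the ball supplies the dominating function
for the limit equation. -/
theorem exists_fixedPoint (hh : IsContractiveKernel h w M κ) {p : α → ℝ → X × Y}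
    (hp : Measurable (Function.uncurry p)) {C : α → ℝ}
    (hC : ∀ a t, sumNorm (p a t) ≤ C a * w a t) :
    ∃ u : α → ℝ → X × Y, Measurable (Function.uncurry u) ∧
      (∀ a t, sumNorm (u a t) ≤ C a / (1 - κ) * w a t) ∧
      ∀ a t, u a t = p a t + ∫ τ, h a t τ (u a τ) := by
  have h1 : 0 < 1 - κ := sub_pos.2 hh.lt_one
  have hmk := hh.measurable_iterate hp
  have hm : ∀ k a, Measurable (iterate h p k a) := fun k a =>
    (hmk k).comp measurable_prodMk_left
  have hC0 : ∀ a, 0 ≤ C a := fun a =>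
    nonneg_of_mul_nonneg_left ((sumNorm_nonneg _).trans (hC a 0)) (hh.weight_pos a 0)
  -- The radius `C / (1 - κ)` is the solution of `r = C + κ r`, so the ball is mapped into itself.
  have hb : ∀ k a t, sumNorm (iterate h p k a t) ≤ C a / (1 - κ) * w a t := by
    intro k a
    induction k with
    | zero =>
      intro t
      simpa [iterate] using mul_nonneg (div_nonneg (hC0 a) h1.le) (hh.weight_pos a t).le
    | succ k ih =>
      intro t
      refine (sumNorm_add_le _ _).trans ((add_le_add (hC a t)
        (hh.sumNorm_integral_le (hm k a) ih t)).trans_eq ?_)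
      field_simp
      ring
  have hd : ∀ k a t, sumNorm (iterate h p k a t - iterate h p (k + 1) a t)
      ≤ C a * κ ^ k * w a t := by
    intro k a
    induction k with
    | zero =>
      intro t
      have := hC a t
      simp only [sumNorm] at this ⊢
      simpa [iterate, hh.map_zero] using this
    | succ k ih =>
      intro t
      have := hh.sumNorm_integral_sub_le (hm k a) (hm (k + 1) a) (hb k a) (hb (k + 1) a) ih t
      have he : iterate h p (k + 1) a t - iterate h p (k + 1 + 1) a t =
          (∫ τ, h a t τ (iterate h p k a τ)) - ∫ τ, h a t τ (iterate h p (k + 1) a τ) := by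
        simp only [iterate]; abel
      rw [he]
      exact this.trans_eq (by ring)
  have hcauchy : ∀ a t, ∃ x, Tendsto (fun k => iterate h p k a t) atTop (𝓝 x) := fun a t => by
    refine cauchySeq_tendsto_of_complete
      (cauchySeq_of_le_geometric κ (C a * w a t) hh.lt_one fun k => ?_)
    rw [dist_eq_norm]
    exact (norm_le_sumNorm _).trans ((hd k a t).trans_eq (by ring))
  choose u hu using hcauchy
  have hub : ∀ a t, sumNorm (u a t) ≤ C a / (1 - κ) * w a t := fun a t =>
    le_of_tendsto (continuous_sumNorm.continuousAt.tendsto.comp (hu a t))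
      (Eventually.of_forall fun k => hb k a t)
  refine ⟨u, ?_, hub, fun a t => ?_⟩
  · exact measurable_of_tendsto_metrizable hmk
      (tendsto_pi_nhds.2 fun x => hu x.1 x.2)
  · have hlim : Tendsto (fun k => iterate h p (k + 1) a t) atTop
        (𝓝 (p a t + ∫ τ, h a t τ (u a τ))) := by
      refine Tendsto.const_add _ (tendsto_integral_of_dominated_convergence
        (fun τ => w a t * (C a / (1 - κ)) * M t τ)
        (fun k => (hh.measurable_section a t (hm k a)).aestronglyMeasurable)
        ((hh.integrable t).const_mul _) (fun k => ae_of_all _ fun τ => ?_)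
        (ae_of_all _ fun τ => ?_))
      · exact (norm_le_sumNorm _).trans (hh.sumNorm_le (hb k a τ))
      · exact (hh.continuous_right a t τ).continuousAt.tendsto.comp (hu a τ)
    exact tendsto_nhds_unique ((tendsto_add_atTop_iff_nat 1).2 (hu a t)) hlim

end IsContractiveKernel

end WeightedFixedPoint

/-! ### Measurability and path continuity of the Ornstein–Uhlenbeck variable -/

section OrnsteinUhlenbeck

variable {Ω : Type*} [MeasurableSpace Ω] {P : Measure Ω} {θ : ℝ → Ω → Ω} {W : ℝ → Ω → ℝ}

theorem measurable_ouVar (hW : IsTwoSidedWiener P θ W) : Measurable (ouVar W) := by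
  have hmeas : Measurable fun p : Ω × ℝ => W p.2 p.1 :=
    (measurable_uncurry_of_continuous_of_measurable (u := W)
      hW.continuous hW.measurable).comp measurable_swap
  have hmeas' : Measurable fun p : Ω × ℝ => Real.exp p.2 * W p.2 p.1 :=
    (Real.measurable_exp.comp measurable_snd).mul hmeas
  exact (hmeas'.stronglyMeasurable.integral_prod_right' (ν := volume.restrict (Iic 0))).measurable.neg

/-- The stationary Ornstein–Uhlenbeck process has continuous paths for every `ω`: where the
defining integral diverges it does so along the whole orbit. -/
theorem continuous_ouVar_flow (hW : IsTwoSidedWiener P θ W) (ω : Ω) :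
    Continuous fun t => ouVar W (θ t ω) := by
  have hc : Continuous fun τ => Real.exp τ * W τ ω :=
    Real.continuous_exp.mul (hW.continuous ω)
  have hfun : ∀ t τ, Real.exp (-t) * (Real.exp (τ + t) * W (τ + t) ω) =
      Real.exp τ * W (τ + t) ω := fun t τ => by
    rw [← mul_assoc, ← Real.exp_add]; ring_nf
  have hpre : ∀ t : ℝ, (fun x : ℝ => x + t) ⁻¹' Iic t = Iic 0 := fun t => by ext x; simp
  have hexp : ∀ t, IntegrableOn (fun τ : ℝ => Real.exp τ * W t ω) (Iic 0) := fun t =>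
    (integrableOn_exp_Iic 0).mul_const _
  -- Substituting `τ + t` for `τ` costs only the constant factor `e^{-t}`, so convergence at `θ_t ω`
  -- amounts to convergence over `Iic t` for `ω`.
  have hshift : ∀ t, IntegrableOn (fun τ => Real.exp τ * W (τ + t) ω) (Iic 0) ↔
      IntegrableOn (fun τ => Real.exp τ * W τ ω) (Iic t) := fun t => by
    rw [← (measurePreserving_add_right (volume : Measure ℝ) t).integrableOn_comp_preimage
      (measurableEmbedding_addRight t) (s := Iic t), hpre]
    simp only [← hfun t, Function.comp_def]
    exact integrable_const_mul_iff (isUnit_iff_ne_zero.2 (Real.exp_pos _).ne') _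
  by_cases hω : IntegrableOn (fun τ => Real.exp τ * W τ ω) (Iic 0)
  · have hI : ∀ t, IntegrableOn (fun τ => Real.exp τ * W τ ω) (Iic t) := fun t => by
      refine IntegrableOn.mono_set (hω.union (hc.integrableOn_Icc (a := 0) (b := t)))
        fun x hx => ?_
      rcases le_total x 0 with h | h
      · exact Or.inl h
      · exact Or.inr ⟨h, hx⟩
    have hz : ∀ t, ouVar W (θ t ω) = W t ω - Real.exp (-t) *
        ((∫ s in Iic (0 : ℝ), Real.exp s * W s ω) + ∫ s in (0 : ℝ)..t, Real.exp s * W s ω) := by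
      intro t
      rw [← intervalIntegral.integral_Iic_sub_Iic (hI 0) (hI t), add_sub_cancel]
      simp only [ouVar, hW.shift, mul_sub]
      rw [integral_sub ((hshift t).2 (hI t)) (hexp t), integral_mul_const, integral_exp_Iic_zero,
        ← integral_const_mul, ← (measurePreserving_add_right (volume : Measure ℝ)
          t).setIntegral_preimage_emb (measurableEmbedding_addRight t) _ (Iic t), hpre]
      simp_rw [hfun]
      ring
    simp_rw [hz]
    exact (hW.continuous ω).sub ((Real.continuous_exp.comp continuous_neg).mul
      (continuous_const.add (intervalIntegral.continuous_primitive
        (fun a b => hc.intervalIntegrable a b) 0)))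
  -- Convergence at one point of the orbit would give convergence at `ω`, since only a compact
  -- interval is added. Hence every integral on the orbit takes its default value zero.
  · have hz : ∀ t, ouVar W (θ t ω) = 0 := fun t => by
      rw [ouVar, neg_eq_zero]
      refine integral_undef fun hi => hω ?_
      simp only [hW.shift, mul_sub] at hi
      have h1 : IntegrableOn (fun τ => Real.exp τ * W (τ + t) ω) (Iic 0) := by
        refine (hi.add (hexp t)).congr (ae_of_all _ fun τ => ?_)
        simp
      refine IntegrableOn.mono_set (((hshift t).1 h1).union
        (hc.integrableOn_Icc (a := t) (b := 0))) fun x hx => ?_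
      rcases le_total x t with h | h
      · exact Or.inl h
      · exact Or.inr ⟨h, hx⟩
    simp_rw [hz]
    exact continuous_const

end OrnsteinUhlenbeck

/-! ### Scalar kernels and their exponential majorants -/

section Kernels

/-- The signed indicator function of the interval between `0` and `t`. -/
def signedIoc (t τ : ℝ) : ℝ := (Ioc 0 t).indicator 1 τ - (Ioc t 0).indicator 1 τ

theorem measurable_signedIoc : Measurable fun q : ℝ × ℝ => signedIoc q.1 q.2 := by
  refine Measurable.sub (Measurable.indicator (s := {q : ℝ × ℝ | 0 < q.2 ∧ q.2 ≤ q.1})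
    (measurable_const (a := (1 : ℝ))) ?_) (Measurable.indicator
      (s := {q : ℝ × ℝ | q.1 < q.2 ∧ q.2 ≤ 0}) (measurable_const (a := (1 : ℝ))) ?_)
  · exact (measurableSet_lt measurable_const measurable_snd).inter
      (measurableSet_le measurable_snd measurable_fst)
  · exact (measurableSet_lt measurable_fst measurable_snd).inter
      (measurableSet_le measurable_snd measurable_const)

/-- Brings integrals from `0` to `t`, of either orientation, into the whole-line form required of a
contractive kernel. -/
theorem integral_signedIoc_smul {F : Type*} [NormedAddCommGroup F] [NormedSpace ℝ F] (t : ℝ)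
    (f : ℝ → F) : ∫ τ, signedIoc t τ • f τ = ∫ τ in (0 : ℝ)..t, f τ := by
  rcases le_total 0 t with h | h
  · rw [intervalIntegral.integral_of_le h, ← integral_indicator measurableSet_Ioc]
    congr 1 with τ
    by_cases hτ : τ ∈ Ioc 0 t <;> simp [signedIoc, h, hτ]
  · rw [intervalIntegral.integral_of_ge h, ← integral_indicator measurableSet_Ioc,
      ← integral_neg]
    congr 1 with τ
    by_cases hτ : τ ∈ Ioc t 0 <;> simp [signedIoc, h, hτ]

/-- A majorant, of integral `1 / c`, of `e^{-c |t - τ|}` between `0` and `t`. -/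
def centerMajorant (c t τ : ℝ) : ℝ :=
  if 0 ≤ t then (Iic t).indicator (fun τ => Real.exp (-c * (t - τ))) τ
  else (Ioi t).indicator (fun τ => Real.exp (c * (t - τ))) τ

theorem centerMajorant_nonneg (c t τ : ℝ) : 0 ≤ centerMajorant c t τ := by
  unfold centerMajorant
  split_ifs <;> exact indicator_nonneg (fun _ _ => (Real.exp_pos _).le) _

/-- For `τ` between `0` and `t`, `|t| = |τ| + |t - τ|`, so the exponents add up to `η|t| - (η - γ)|t
- τ|`. The majorant continues past `0` to a half-line, which makes its integral independent of `t`.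
-/
theorem abs_signedIoc_mul_le (γ η t τ : ℝ) :
    |signedIoc t τ| * Real.exp (γ * |t - τ|) * Real.exp (η * |τ|) ≤
      Real.exp (η * |t|) * centerMajorant (η - γ) t τ := by
  have hn := mul_nonneg (Real.exp_pos (η * |t|)).le (centerMajorant_nonneg (η - γ) t τ)
  rcases le_or_gt 0 t with h | h
  · by_cases hτ : τ ∈ Ioc 0 t
    · have h1 : signedIoc t τ = 1 := by simp [signedIoc, hτ, h]
      rw [h1, abs_one, one_mul, centerMajorant, if_pos h, indicator_of_mem (mem_Iic.2 hτ.2),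
        abs_of_nonneg h, abs_of_pos hτ.1, abs_of_nonneg (sub_nonneg.2 hτ.2), ← Real.exp_add,
        ← Real.exp_add]
      exact (congrArg Real.exp (by ring)).le
    · have h1 : signedIoc t τ = 0 := by simp [signedIoc, hτ, h]
      simpa [h1] using hn
  · by_cases hτ : τ ∈ Ioc t 0
    · have h1 : signedIoc t τ = -1 := by simp [signedIoc, hτ, h.le]
      rw [h1, abs_neg, abs_one, one_mul, centerMajorant, if_neg h.not_ge,
        indicator_of_mem (mem_Ioi.2 hτ.1), abs_of_neg h, abs_of_nonpos hτ.2,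
        abs_of_nonpos (sub_nonpos.2 hτ.1.le), ← Real.exp_add, ← Real.exp_add]
      exact (congrArg Real.exp (by ring)).le
    · have h1 : signedIoc t τ = 0 := by simp [signedIoc, hτ, h.le]
      simpa [h1] using hn

theorem integrableOn_exp_neg_mul_sub {c : ℝ} (hc : 0 < c) (t : ℝ) :
    IntegrableOn (fun τ => Real.exp (-c * (t - τ))) (Iic t) := by
  have he : (fun τ => Real.exp (-c * (t - τ))) = fun τ => Real.exp (-c * t) * Real.exp (c * τ) := by
    ext τ; rw [← Real.exp_add]; ring_nf
  rw [he]
  exact (integrableOn_exp_mul_Iic hc t).const_mul _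

theorem integral_exp_neg_mul_sub {c : ℝ} (hc : 0 < c) (t : ℝ) :
    ∫ τ in Iic t, Real.exp (-c * (t - τ)) = 1 / c := by
  have he : (fun τ => Real.exp (-c * (t - τ))) = fun τ => Real.exp (-c * t) * Real.exp (c * τ) := by
    ext τ; rw [← Real.exp_add]; ring_nf
  rw [he, integral_const_mul, integral_exp_mul_Iic hc, mul_div_assoc', ← Real.exp_add]
  simp

theorem integrableOn_exp_mul_sub {c : ℝ} (hc : 0 < c) (t : ℝ) :
    IntegrableOn (fun τ => Real.exp (c * (t - τ))) (Ioi t) := by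
  have he : (fun τ => Real.exp (c * (t - τ))) = fun τ => Real.exp (c * t) * Real.exp (-c * τ) := by
    ext τ; rw [← Real.exp_add]; ring_nf
  rw [he]
  exact (integrableOn_exp_mul_Ioi (neg_lt_zero.2 hc) t).const_mul _

theorem integral_exp_mul_sub {c : ℝ} (hc : 0 < c) (t : ℝ) :
    ∫ τ in Ioi t, Real.exp (c * (t - τ)) = 1 / c := by
  have he : (fun τ => Real.exp (c * (t - τ))) = fun τ => Real.exp (c * t) * Real.exp (-c * τ) := by
    ext τ; rw [← Real.exp_add]; ring_nf
  rw [he, integral_const_mul, integral_exp_mul_Ioi (neg_lt_zero.2 hc), mul_div_assoc', mul_neg,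
    ← Real.exp_add, neg_div_neg_eq]
  simp

theorem integrable_centerMajorant {c : ℝ} (hc : 0 < c) (t : ℝ) :
    Integrable (centerMajorant c t) := by
  unfold centerMajorant
  split_ifs
  · exact (integrableOn_exp_neg_mul_sub hc t).integrable_indicator measurableSet_Iic
  · exact (integrableOn_exp_mul_sub hc t).integrable_indicator measurableSet_Ioi

theorem integral_centerMajorant {c : ℝ} (hc : 0 < c) (t : ℝ) :
    ∫ τ, centerMajorant c t τ = 1 / c := by
  unfold centerMajorant
  split_ifs
  · rw [integral_indicator measurableSet_Iic, integral_exp_neg_mul_sub hc]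
  · rw [integral_indicator measurableSet_Ioi, integral_exp_mul_sub hc]

/-- The function `e^{-c (t - τ)}` for `τ ≤ t`, extended by zero. -/
def stableMajorant (c t τ : ℝ) : ℝ := (Iic t).indicator (fun τ => Real.exp (-c * (t - τ))) τ

theorem stableMajorant_nonneg (c t τ : ℝ) : 0 ≤ stableMajorant c t τ :=
  indicator_nonneg (fun _ _ => (Real.exp_pos _).le) _

theorem integrable_stableMajorant {c : ℝ} (hc : 0 < c) (t : ℝ) :
    Integrable (stableMajorant c t) :=
  (integrableOn_exp_neg_mul_sub hc t).integrable_indicator measurableSet_Iic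

theorem integral_stableMajorant {c : ℝ} (hc : 0 < c) (t : ℝ) :
    ∫ τ, stableMajorant c t τ = 1 / c :=
  (integral_indicator measurableSet_Iic).trans (integral_exp_neg_mul_sub hc t)

/-- The triangle inequality `|τ| ≤ |t| + (t - τ)`, multiplied by `η ≥ 0`, lowers the decay rate from
`β` to `β - η`. -/
theorem exp_mul_exp_abs_le {β η t τ : ℝ} (hη : 0 ≤ η) (h : τ ≤ t) :
    Real.exp (-β * (t - τ)) * Real.exp (η * |τ|) ≤
      Real.exp (η * |t|) * stableMajorant (β - η) t τ := by
  rw [stableMajorant, indicator_of_mem (mem_Iic.2 h), ← Real.exp_add, ← Real.exp_add,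
    Real.exp_le_exp]
  have h1 : |τ| ≤ |t| + (t - τ) := by
    have := abs_sub_abs_le_abs_sub τ t
    rw [abs_of_nonpos (sub_nonpos.2 h)] at this
    linarith
  nlinarith

end Kernels

/-! ### Exponentials of a bounded operator -/

section OperatorExponential

variable {V : Type*} [NormedAddCommGroup V] [NormedSpace ℝ V]

theorem exp_zero_smul_apply (A : V →L[ℝ] V) (x : V) :
    NormedSpace.exp ((0 : ℝ) • A) x = x := by simp

theorem exp_smul_zero_apply (s : ℝ) (x : V) :
    NormedSpace.exp (s • (0 : V →L[ℝ] V)) x = x := by simp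

variable [CompleteSpace V]

theorem continuous_exp_smul (A : V →L[ℝ] V) :
    Continuous fun t : ℝ => NormedSpace.exp (t • A) :=
  continuous_iff_continuousAt.2 fun t => (hasDerivAt_exp_smul_const' (𝕂 := ℝ) A t).continuousAt

theorem exp_add_smul_apply (A : V →L[ℝ] V) (s t : ℝ) (x : V) :
    NormedSpace.exp ((s + t) • A) x = NormedSpace.exp (s • A) (NormedSpace.exp (t • A) x) := by
  let : NormedAlgebra ℚ (V →L[ℝ] V) := NormedAlgebra.restrictScalars ℚ ℝ _
  rw [add_smul, NormedSpace.exp_add_of_commute]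
  · rfl
  · exact ((Commute.refl A).smul_left s).smul_right t

theorem hasDerivAt_smul_exp_smul (A : V →L[ℝ] V) {f : ℝ → ℝ} {c t : ℝ}
    (hf : HasDerivAt f (f t * c) t) :
    HasDerivAt (fun t => f t • NormedSpace.exp (t • A))
      (c • (f t • NormedSpace.exp (t • A)) + A * (f t • NormedSpace.exp (t • A))) t := by
  refine (hf.smul (hasDerivAt_exp_smul_const' A t)).congr_deriv ?_
  rw [mul_smul_comm, smul_smul, add_comm, mul_comm c]

end OperatorExponential

/-! ### The linear propagator and variation of constants -/

section Propagator

variable {Ω : Type*} {k : ℕ} {θ : ℝ → Ω → Ω} {z : Ω → ℝ} {ε : ℝ} {A : E k →L[ℝ] E k}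

@[simp] theorem propagator_self (ω : Ω) (t : ℝ) (x : E k) :
    propagator θ z ε A ω t t x = x := by
  simp only [propagator, intervalIntegral.integral_same, mul_zero, Real.exp_zero, one_smul,
    sub_self]
  exact exp_zero_smul_apply A x

theorem norm_propagator_apply (ω : Ω) (τ t : ℝ) (x : E k) :
    ‖propagator θ z ε A ω τ t x‖ =
      Real.exp (ε * ∫ r in τ..t, z (θ r ω)) * ‖NormedSpace.exp ((t - τ) • A) x‖ := by
  simp [propagator, norm_smul]

theorem norm_propagator_zero_apply (ω : Ω) (τ t : ℝ) (x : E k) :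
    ‖propagator θ z ε 0 ω τ t x‖ = Real.exp (ε * ∫ r in τ..t, z (θ r ω)) * ‖x‖ := by
  rw [norm_propagator_apply]
  exact congrArg (fun y => _ * ‖y‖) (exp_smul_zero_apply (t - τ) x)

/-- The evolution property holds for times in any order, because `e^{sA}` is defined for negative
`s` too. Propagators can thus be pulled out of integrals and run backwards. -/
theorem propagator_propagator {ω : Ω} (hz : Continuous fun t => z (θ t ω)) (τ r t : ℝ) (x : E k) :
    propagator θ z ε A ω r t (propagator θ z ε A ω τ r x) = propagator θ z ε A ω τ t x := by
  have h1 := intervalIntegral.integral_add_adjacent_intervals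
    (hz.intervalIntegrable (μ := volume) τ r) (hz.intervalIntegrable r t)
  have h2 : t - τ = (t - r) + (r - τ) := by ring
  simp only [propagator]
  rw [← h1, h2, mul_add, Real.exp_add]
  simp only [smul_apply, map_smul, smul_smul]
  rw [mul_comm]
  exact congrArg (fun y => _ • y) (exp_add_smul_apply A (t - r) (r - τ) x).symm

theorem propagator_flow (hadd : ∀ s t ω, θ (s + t) ω = θ s (θ t ω)) (ω : Ω) (s τ t : ℝ) :
    propagator θ z ε A (θ s ω) τ t = propagator θ z ε A ω (τ + s) (t + s) := by
  simp only [propagator, ← hadd, add_sub_add_right_eq_sub]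
  rw [intervalIntegral.integral_comp_add_right (fun r => z (θ r ω)) s]

theorem continuous_propagator {ω : Ω} (hz : Continuous fun t => z (θ t ω)) :
    Continuous fun q : ℝ × ℝ => propagator θ z ε A ω q.1 q.2 := by
  have hI : Continuous fun t : ℝ => ∫ r in (0 : ℝ)..t, z (θ r ω) :=
    intervalIntegral.continuous_primitive (fun a b => hz.intervalIntegrable a b) 0
  have h1 : Continuous fun q : ℝ × ℝ => ∫ r in q.1..q.2, z (θ r ω) := by
    refine ((hI.comp continuous_snd).sub (hI.comp continuous_fst)).congr fun q => ?_
    exact intervalIntegral.integral_interval_sub_left (hz.intervalIntegrable _ _)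
      (hz.intervalIntegrable _ _)
  exact (Real.continuous_exp.comp (continuous_const.mul h1)).smul
    ((continuous_exp_smul A).comp (continuous_snd.sub continuous_fst))

theorem hasDerivAt_propagator {ω : Ω} (hz : Continuous fun t => z (θ t ω)) (t : ℝ) :
    HasDerivAt (fun t => propagator θ z ε A ω 0 t)
      ((ε * z (θ t ω)) • propagator θ z ε A ω 0 t + A * propagator θ z ε A ω 0 t) t := by
  have h1 : HasDerivAt (fun t => Real.exp (ε * ∫ r in (0 : ℝ)..t, z (θ r ω)))
      (Real.exp (ε * ∫ r in (0 : ℝ)..t, z (θ r ω)) * (ε * z (θ t ω))) t :=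
    ((intervalIntegral.integral_hasDerivAt_right (hz.intervalIntegrable _ _)
      (hz.stronglyMeasurableAtFilter _ _) hz.continuousAt).const_mul ε).exp
  simp only [propagator, sub_zero]
  exact hasDerivAt_smul_exp_smul A h1

/-- Variation of constants. -/
theorem hasDerivAt_duhamel {ω : Ω} (hz : Continuous fun t => z (θ t ω)) (ξ : E k) {F : ℝ → E k}
    (hF : Continuous F) (t : ℝ) :
    HasDerivAt (fun t => propagator θ z ε A ω 0 t ξ +
        ∫ τ in (0 : ℝ)..t, propagator θ z ε A ω τ t (F τ))
      (A (propagator θ z ε A ω 0 t ξ + ∫ τ in (0 : ℝ)..t, propagator θ z ε A ω τ t (F τ)) +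
        (ε * z (θ t ω)) • (propagator θ z ε A ω 0 t ξ +
          ∫ τ in (0 : ℝ)..t, propagator θ z ε A ω τ t (F τ)) + F t) t := by
  have hc : Continuous fun τ => propagator θ z ε A ω τ 0 (F τ) :=
    ((continuous_propagator hz).comp (continuous_id.prodMk continuous_const)).clm_apply hF
  -- Factoring the propagator through time `0` leaves an integrand independent of `t`; the product
  -- rule and the fundamental theorem of calculus then apply.
  have he : ∀ t, propagator θ z ε A ω 0 t ξ + ∫ τ in (0 : ℝ)..t, propagator θ z ε A ω τ t (F τ) =
      propagator θ z ε A ω 0 t (ξ + ∫ τ in (0 : ℝ)..t, propagator θ z ε A ω τ 0 (F τ)) := by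
    intro t
    rw [map_add, ← ContinuousLinearMap.intervalIntegral_comp_comm _ (hc.intervalIntegrable _ _)]
    simp_rw [propagator_propagator hz]
  simp_rw [he]
  have hv : HasDerivAt (fun t => ξ + ∫ τ in (0 : ℝ)..t, propagator θ z ε A ω τ 0 (F τ))
      (propagator θ z ε A ω t 0 (F t)) t :=
    (intervalIntegral.integral_hasDerivAt_right (hc.intervalIntegrable _ _)
      (hc.stronglyMeasurableAtFilter _ _) hc.continuousAt).const_add _
  refine ((hasDerivAt_propagator hz t).clm_apply hv).congr_deriv ?_
  rw [propagator_propagator hz, propagator_self, add_apply,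
    smul_apply, mul_apply_eq_comp, add_comm (A _)]

/-- The variation of constants formula started at time `s`. -/
theorem duhamel_restart {ω : Ω} (hz : Continuous fun t => z (θ t ω)) (ξ : E k) {F : ℝ → E k}
    (hF : Continuous F) (s t : ℝ) :
    propagator θ z ε A ω s t (propagator θ z ε A ω 0 s ξ +
        ∫ τ in (0 : ℝ)..s, propagator θ z ε A ω τ s (F τ)) +
      ∫ τ in s..t, propagator θ z ε A ω τ t (F τ) =
    propagator θ z ε A ω 0 t ξ + ∫ τ in (0 : ℝ)..t, propagator θ z ε A ω τ t (F τ) := by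
  have hc : ∀ s, Continuous fun τ => propagator θ z ε A ω τ s (F τ) := fun s =>
    ((continuous_propagator hz).comp (continuous_id.prodMk continuous_const)).clm_apply hF
  rw [map_add, ← ContinuousLinearMap.intervalIntegral_comp_comm _ ((hc s).intervalIntegrable _ _)]
  simp_rw [propagator_propagator hz]
  rw [add_assoc, intervalIntegral.integral_add_adjacent_intervals ((hc t).intervalIntegrable _ _)
    ((hc t).intervalIntegrable _ _)]

/-- An integral over the whole past satisfies the variation of constants formula. -/
theorem integral_past_eq_duhamel {ω : Ω} (hz : Continuous fun t => z (θ t ω)) {F : ℝ → E k}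
    (hF : ∀ t, IntegrableOn (fun τ => propagator θ z ε A ω τ t (F τ)) (Iic t)) (t : ℝ) :
    ∫ τ in Iic t, propagator θ z ε A ω τ t (F τ) =
      propagator θ z ε A ω 0 t (∫ τ in Iic (0 : ℝ), propagator θ z ε A ω τ 0 (F τ)) +
        ∫ τ in (0 : ℝ)..t, propagator θ z ε A ω τ t (F τ) := by
  have h0 : IntegrableOn (fun τ => propagator θ z ε A ω τ t (F τ)) (Iic 0) := by
    have := (propagator θ z ε A ω 0 t).integrable_comp (hF 0)
    simp only [propagator_propagator hz] at this
    exact this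
  rw [← ContinuousLinearMap.integral_comp_comm _ (hF 0)]
  simp_rw [propagator_propagator hz]
  rw [← intervalIntegral.integral_Iic_sub_Iic h0 (hF t), add_sub_cancel]

variable [MeasurableSpace Ω]

/-- A Carathéodory argument: the integral is continuous in the time and, for fixed time, measurable
in `ω`. -/
theorem measurable_integral_flow (hθ : Measurable fun p : ℝ × Ω => θ p.1 p.2) (hz : Measurable z)
    (hzc : ∀ ω, Continuous fun t => z (θ t ω)) :
    Measurable fun p : ℝ × Ω => ∫ r in (0 : ℝ)..p.1, z (θ r p.2) := by
  refine measurable_uncurry_of_continuous_of_measurable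
    (u := fun t ω => ∫ r in (0 : ℝ)..t, z (θ r ω)) (fun ω => ?_) fun t => ?_
  · exact intervalIntegral.continuous_primitive (fun a b => (hzc ω).intervalIntegrable a b) 0
  · have h1 : StronglyMeasurable fun p : Ω × ℝ => z (θ p.2 p.1) :=
      (hz.comp (hθ.comp measurable_swap)).stronglyMeasurable
    exact (h1.integral_prod_right' (ν := volume.restrict (Ioc 0 t))).measurable.sub
      (h1.integral_prod_right' (ν := volume.restrict (Ioc t 0))).measurable

theorem measurable_propagator (hθ : Measurable fun p : ℝ × Ω => θ p.1 p.2) (hz : Measurable z)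
    (hzc : ∀ ω, Continuous fun t => z (θ t ω)) {B : Type*} [MeasurableSpace B] {ω : B → Ω}
    {τ t : B → ℝ} {x : B → E k} (hω : Measurable ω) (hτ : Measurable τ) (ht : Measurable t)
    (hx : Measurable x) : Measurable fun b => propagator θ z ε A (ω b) (τ b) (t b) (x b) := by
  have hI := measurable_integral_flow hθ hz hzc
  have h1 : Measurable fun b => ∫ r in τ b..t b, z (θ r (ω b)) := by
    have := (hI.comp (ht.prodMk hω)).sub (hI.comp (hτ.prodMk hω))
    convert this using 2 with b
    exact (intervalIntegral.integral_interval_sub_left ((hzc _).intervalIntegrable _ _)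
      ((hzc _).intervalIntegrable _ _)).symm
  have h2 : Continuous fun q : ℝ × E k => NormedSpace.exp (q.1 • A) q.2 :=
    ((continuous_exp_smul A).comp continuous_fst).clm_apply continuous_snd
  exact (Real.measurable_exp.comp (h1.const_mul ε)).smul
    (h2.measurable.comp ((ht.sub hτ).prodMk hx))

end Propagator

/-! ### The random exponential weight -/

section Weight

variable {Ω : Type*} {k : ℕ} {θ : ℝ → Ω → Ω} {z : Ω → ℝ} {ε η : ℝ}

/-- The weight `e^{η |t| + ε ∫_0^t z(θ_r ω) dr}`. -/
def expWeight (θ : ℝ → Ω → Ω) (z : Ω → ℝ) (ε η : ℝ) (ω : Ω) (t : ℝ) : ℝ :=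
  Real.exp (ε * ∫ r in (0 : ℝ)..t, z (θ r ω)) * Real.exp (η * |t|)

theorem expWeight_pos (ω : Ω) (t : ℝ) : 0 < expWeight θ z ε η ω t := by
  unfold expWeight; positivity

@[simp] theorem expWeight_zero (ω : Ω) : expWeight θ z ε η ω 0 = 1 := by simp [expWeight]

/-- The random factor of the propagator is absorbed into the weight. This is why the contraction
constants do not depend on `ω`. -/
theorem exp_integral_mul_expWeight {ω : Ω} (hz : Continuous fun t => z (θ t ω)) (τ t : ℝ) :
    Real.exp (ε * ∫ r in τ..t, z (θ r ω)) * expWeight θ z ε η ω τ =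
      Real.exp (ε * ∫ r in (0 : ℝ)..t, z (θ r ω)) * Real.exp (η * |τ|) := by
  rw [expWeight, ← mul_assoc, ← Real.exp_add, ← mul_add, add_comm,
    intervalIntegral.integral_add_adjacent_intervals
    (hz.intervalIntegrable (μ := volume) 0 τ) (hz.intervalIntegrable τ t)]

theorem memWeighted_iff {ω : Ω} {x : ℝ → E k} :
    MemWeighted θ z ε η ω x ↔ Continuous x ∧ ∃ C, ∀ t, ‖x t‖ ≤ C * expWeight θ z ε η ω t := by
  refine and_congr_right fun _ => exists_congr fun C => ?_
  rw [mem_upperBounds, forall_mem_range]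
  refine forall_congr' fun t => ?_
  rw [norm_smul, Real.norm_of_nonneg (by positivity), ← div_le_iff₀ (expWeight_pos ω t),
    div_eq_inv_mul]
  congr! 2
  rw [expWeight, mul_inv, ← Real.exp_neg, ← Real.exp_neg, mul_comm, neg_mul, neg_mul]

end Weight

/-! ### The rescaled nonlinearity -/

section Rescale

variable {n m k : ℕ} {f : E n × E m → E k} {L : ℝ}

theorem continuous_rescale (hf : Continuous f) :
    Continuous fun q : ℝ × E n × E m => rescale f q.1 q.2 := by
  unfold rescale; fun_prop

theorem rescale_zero (hf0 : f 0 = 0) (c : ℝ) : rescale f c 0 = 0 := by simp [rescale, hf0]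

/-- The inner factor `e^c` and the outer factor `e^{-c}` cancel, so the constant `L` is uniform in
`c`, hence in `ω` and in time. -/
theorem norm_rescale_sub_le
    (hf : ∀ x₁ x₂ y₁ y₂, ‖f (x₁, y₁) - f (x₂, y₂)‖ ≤ L * (‖x₁ - x₂‖ + ‖y₁ - y₂‖))
    (c : ℝ) (u v : E n × E m) : ‖rescale f c u - rescale f c v‖ ≤ L * sumNorm (u - v) := by
  have h1 := hf (Real.exp c • u.1) (Real.exp c • v.1) (Real.exp c • u.2) (Real.exp c • v.2)
  rw [← smul_sub, ← smul_sub, norm_smul, norm_smul, Real.norm_of_nonneg (Real.exp_pos c).le,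
    ← mul_add] at h1
  rw [rescale, rescale, ← smul_sub, norm_smul, Real.norm_of_nonneg (Real.exp_pos _).le]
  have h2 := mul_le_mul_of_nonneg_left h1 (Real.exp_pos (-c)).le
  refine h2.trans_eq ?_
  have h3 : Real.exp (-c) * Real.exp c = 1 := by rw [← Real.exp_add]; simp
  simp only [sumNorm, Prod.fst_sub, Prod.snd_sub]
  linear_combination L * (‖u.1 - v.1‖ + ‖u.2 - v.2‖) * h3

end Rescale

/-! ### Continuity of variation of constants integrals -/

section Duhamel

variable {Ω : Type*} {k : ℕ} {θ : ℝ → Ω → Ω} {z : Ω → ℝ} {ε : ℝ} {A : E k →L[ℝ] E k}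

theorem intervalIntegrable_of_signedIoc {F : Type*} [NormedAddCommGroup F] [NormedSpace ℝ F]
    {t : ℝ} {f : ℝ → F} (hf : Integrable fun τ => signedIoc t τ • f τ) :
    IntervalIntegrable f volume 0 t := by
  constructor
  · refine (hf.integrableOn (s := Ioc 0 t)).congr_fun (fun τ hτ => ?_) measurableSet_Ioc
    have : τ ∉ Ioc t 0 := fun h => absurd h.1 hτ.2.not_gt
    simp only [signedIoc, indicator_of_mem hτ, indicator_of_notMem this]
    simp
  · refine (hf.neg.integrableOn (s := Ioc t 0)).congr_fun (fun τ hτ => ?_) measurableSet_Ioc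
    have : τ ∉ Ioc 0 t := fun h => absurd h.2 hτ.1.not_ge
    simp only [signedIoc, Pi.neg_apply, indicator_of_mem hτ, indicator_of_notMem this]
    simp

/-- Fixed points are at first only measurable in time, so integrability replaces continuity of `F`.
This is the regularity step that makes them continuous. -/
theorem continuous_duhamel {ω : Ω} (hz : Continuous fun t => z (θ t ω)) (ξ : E k) {F : ℝ → E k}
    (hF : ∀ t, IntervalIntegrable (fun τ => propagator θ z ε A ω τ t (F τ)) volume 0 t) :
    Continuous fun t => propagator θ z ε A ω 0 t ξ +
      ∫ τ in (0 : ℝ)..t, propagator θ z ε A ω τ t (F τ) := by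
  have h0 : ∀ t, IntervalIntegrable (fun τ => propagator θ z ε A ω τ 0 (F τ)) volume 0 t := by
    intro t
    have h1 := (propagator θ z ε A ω t 0).integrable_comp (hF t).1
    have h2 := (propagator θ z ε A ω t 0).integrable_comp (hF t).2
    simp only [propagator_propagator hz] at h1 h2
    exact ⟨h1, h2⟩
  have he : ∀ t, propagator θ z ε A ω 0 t ξ + ∫ τ in (0 : ℝ)..t, propagator θ z ε A ω τ t (F τ) =
      propagator θ z ε A ω 0 t (ξ + ∫ τ in (0 : ℝ)..t, propagator θ z ε A ω τ 0 (F τ)) := by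
    intro t
    rw [map_add, ← ContinuousLinearMap.intervalIntegral_comp_comm _ (h0 t)]
    simp_rw [propagator_propagator hz]
  simp_rw [he]
  exact ((continuous_propagator hz).comp (continuous_const.prodMk continuous_id)).clm_apply
    (continuous_const.add (intervalIntegral.continuous_primitive
      (fun a b => (h0 a).symm.trans (h0 b)) 0))

end Duhamel

/-! ### The random dynamical system generated by the equation -/

section SolutionMap

variable {Ω : Type*} {n m : ℕ} {θ : ℝ → Ω → Ω} {z : Ω → ℝ} {ε : ℝ}
  {Ac : E n →L[ℝ] E n} {As : E m →L[ℝ] E m} {fc : E n × E m → E n} {fs : E n × E m → E m} {L : ℝ}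

/-- The integrand of the initial value problem, the scalar linear part having been integrated. -/
def cauchyKernel (θ : ℝ → Ω → Ω) (z : Ω → ℝ) (ε : ℝ)
    (Ac : E n →L[ℝ] E n) (As : E m →L[ℝ] E m) (fc : E n × E m → E n) (fs : E n × E m → E m)
    (ω : Ω) (t τ : ℝ) (u : E n × E m) : E n × E m :=
  (signedIoc t τ • propagator θ z ε 0 ω τ t (Ac u.1 + rescale fc (ε * z (θ τ ω)) u),
   signedIoc t τ • propagator θ z ε 0 ω τ t (As u.2 + rescale fs (ε * z (θ τ ω)) u))

theorem norm_linear_add_rescale_sub_le {k : ℕ} {f : E n × E m → E k} {B : E n × E m →L[ℝ] E k}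
    {b : ℝ} (hB : ∀ u, ‖B u‖ ≤ b * sumNorm u)
    (hf : ∀ x₁ x₂ y₁ y₂, ‖f (x₁, y₁) - f (x₂, y₂)‖ ≤ L * (‖x₁ - x₂‖ + ‖y₁ - y₂‖))
    (c : ℝ) (u v : E n × E m) :
    ‖(B u + rescale f c u) - (B v + rescale f c v)‖ ≤ (b + L) * sumNorm (u - v) := by
  rw [add_sub_add_comm, ← map_sub, add_mul]
  exact (norm_add_le _ _).trans (add_le_add (hB _) (norm_rescale_sub_le hf c u v))

theorem norm_clm_fst_le (u : E n × E m) : ‖Ac u.1‖ ≤ ‖Ac‖ * sumNorm u :=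
  (Ac.le_opNorm _).trans (mul_le_mul_of_nonneg_left
    (le_add_of_nonneg_right (norm_nonneg _)) (norm_nonneg _))

theorem norm_clm_snd_le (u : E n × E m) : ‖As u.2‖ ≤ ‖As‖ * sumNorm u :=
  (As.le_opNorm _).trans (mul_le_mul_of_nonneg_left
    (le_add_of_nonneg_left (norm_nonneg _)) (norm_nonneg _))

theorem norm_center_rhs_sub_le
    (hfcL : ∀ x₁ x₂ y₁ y₂, ‖fc (x₁, y₁) - fc (x₂, y₂)‖ ≤ L * (‖x₁ - x₂‖ + ‖y₁ - y₂‖))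
    (c : ℝ) (u v : E n × E m) :
    ‖(Ac u.1 + rescale fc c u) - (Ac v.1 + rescale fc c v)‖ ≤ (‖Ac‖ + L) * sumNorm (u - v) :=
  norm_linear_add_rescale_sub_le (B := Ac.comp (ContinuousLinearMap.fst ℝ (E n) (E m)))
    norm_clm_fst_le hfcL c u v

theorem norm_stable_rhs_sub_le
    (hfsL : ∀ x₁ x₂ y₁ y₂, ‖fs (x₁, y₁) - fs (x₂, y₂)‖ ≤ L * (‖x₁ - x₂‖ + ‖y₁ - y₂‖))
    (c : ℝ) (u v : E n × E m) :
    ‖(As u.2 + rescale fs c u) - (As v.2 + rescale fs c v)‖ ≤ (‖As‖ + L) * sumNorm (u - v) :=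
  norm_linear_add_rescale_sub_le (B := As.comp (ContinuousLinearMap.snd ℝ (E n) (E m)))
    norm_clm_snd_le hfsL c u v

theorem measurable_rescale_flow [MeasurableSpace Ω] {k : ℕ} {f : E n × E m → E k}
    (hθ : Measurable fun p : ℝ × Ω => θ p.1 p.2) (hz : Measurable z) (hf : Continuous f)
    {B : Type*} [MeasurableSpace B] {ω : B → Ω} {τ : B → ℝ} {u : B → E n × E m}
    (hω : Measurable ω) (hτ : Measurable τ) (hu : Measurable u) :
    Measurable fun b => rescale f (ε * z (θ (τ b) (ω b))) (u b) :=
  (continuous_rescale hf).measurable.comp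
    (((hz.comp (hθ.comp (hτ.prodMk hω))).const_mul ε).prodMk hu)

/-- A Bielecki norm: the integrand has Lipschitz constant `Λ`, and the growth exponent `Λ + 1` gives
the contraction factor `Λ / (Λ + 1)` on the whole time axis. The parameter includes the initial
value, which makes the solution jointly measurable in it. -/
theorem isContractiveKernel_cauchy [MeasurableSpace Ω] (hθ : Measurable fun p : ℝ × Ω => θ p.1 p.2)
    (hz : Measurable z) (hzc : ∀ ω, Continuous fun t => z (θ t ω))
    (hfc : Continuous fc) (hfs : Continuous fs) (hfc0 : fc 0 = 0) (hfs0 : fs 0 = 0)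
    (hL : 0 ≤ L)
    (hfcL : ∀ x₁ x₂ y₁ y₂, ‖fc (x₁, y₁) - fc (x₂, y₂)‖ ≤ L * (‖x₁ - x₂‖ + ‖y₁ - y₂‖))
    (hfsL : ∀ x₁ x₂ y₁ y₂, ‖fs (x₁, y₁) - fs (x₂, y₂)‖ ≤ L * (‖x₁ - x₂‖ + ‖y₁ - y₂‖))
    {Λ : ℝ} (hΛ : Λ = (‖Ac‖ + L) + (‖As‖ + L)) :
    IsContractiveKernel (fun a : Ω × E n × E m => cauchyKernel θ z ε Ac As fc fs a.1)
      (fun a => expWeight θ z ε (Λ + 1) a.1) (fun t τ => Λ * centerMajorant (Λ + 1) t τ)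
      (Λ / (Λ + 1)) := by
  have hΛ0 : 0 ≤ Λ := by rw [hΛ]; positivity
  refine
    { measurable := ?_
      weight_pos := fun a t => expWeight_pos _ _
      map_zero := fun a t τ => by simp [cauchyKernel, rescale_zero, hfc0, hfs0]
      lipschitz := fun a t τ u v => ?_
      nonneg := fun t τ => mul_nonneg hΛ0 (centerMajorant_nonneg _ _ _)
      integrable := fun t => (integrable_centerMajorant (by linarith) t).const_mul _
      integral_le := fun t => ?_
      lt_one := ?_ }
  · have hω : Measurable fun q : ((Ω × E n × E m) × ℝ) × ℝ × E n × E m => q.1.1.1 := by fun_prop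
    have hτ : Measurable fun q : ((Ω × E n × E m) × ℝ) × ℝ × E n × E m => q.2.1 := by fun_prop
    have ht : Measurable fun q : ((Ω × E n × E m) × ℝ) × ℝ × E n × E m => q.1.2 := by fun_prop
    have hu : Measurable fun q : ((Ω × E n × E m) × ℝ) × ℝ × E n × E m => q.2.2 := by fun_prop
    have hs := measurable_signedIoc.comp (ht.prodMk hτ)
    refine Measurable.prodMk (hs.smul (measurable_propagator hθ hz hzc hω hτ ht ?_))
      (hs.smul (measurable_propagator hθ hz hzc hω hτ ht ?_))
    · exact (Ac.measurable.comp hu.fst).add (measurable_rescale_flow hθ hz hfc hω hτ hu)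
    · exact (As.measurable.comp hu.snd).add (measurable_rescale_flow hθ hz hfs hω hτ hu)
  · obtain ⟨ω, u₀⟩ := a
    have h1 : sumNorm (cauchyKernel θ z ε Ac As fc fs ω t τ u -
        cauchyKernel θ z ε Ac As fc fs ω t τ v) ≤
        |signedIoc t τ| * (Real.exp (ε * ∫ r in τ..t, z (θ r ω)) * (Λ * sumNorm (u - v))) := by
      simp only [sumNorm, cauchyKernel, Prod.fst_sub, Prod.snd_sub, ← smul_sub, ← map_sub,
        norm_smul, norm_propagator_zero_apply, Real.norm_eq_abs]
      rw [← mul_add, ← mul_add]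
      gcongr
      rw [hΛ, add_mul]
      exact add_le_add (norm_center_rhs_sub_le hfcL _ u v) (norm_stable_rhs_sub_le hfsL _ u v)
    have h2 := exp_integral_mul_expWeight (ε := ε) (η := Λ + 1) (hzc ω) τ t
    -- The rate is `0` since the propagator is purely scalar here; `Ac` and `As` sit in the
    -- integrand.
    have h3 := abs_signedIoc_mul_le 0 (Λ + 1) t τ
    rw [zero_mul, Real.exp_zero, mul_one, sub_zero] at h3
    have hN := sumNorm_nonneg (u - v)
    calc sumNorm (cauchyKernel θ z ε Ac As fc fs ω t τ u -
          cauchyKernel θ z ε Ac As fc fs ω t τ v) * expWeight θ z ε (Λ + 1) ω τ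
        ≤ |signedIoc t τ| * (Real.exp (ε * ∫ r in τ..t, z (θ r ω)) * (Λ * sumNorm (u - v))) *
          expWeight θ z ε (Λ + 1) ω τ := mul_le_mul_of_nonneg_right h1 (expWeight_pos _ _).le
      _ = |signedIoc t τ| * (Real.exp (ε * ∫ r in τ..t, z (θ r ω)) *
          expWeight θ z ε (Λ + 1) ω τ) * (Λ * sumNorm (u - v)) := by ring
      _ = Real.exp (ε * ∫ r in (0 : ℝ)..t, z (θ r ω)) * (Λ * sumNorm (u - v)) *
          (|signedIoc t τ| * Real.exp ((Λ + 1) * |τ|)) := by rw [h2]; ring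
      _ ≤ Real.exp (ε * ∫ r in (0 : ℝ)..t, z (θ r ω)) * (Λ * sumNorm (u - v)) *
          (Real.exp ((Λ + 1) * |t|) * centerMajorant (Λ + 1) t τ) :=
        mul_le_mul_of_nonneg_left h3 (by positivity)
      _ = _ := by rw [expWeight]; ring
  · rw [integral_const_mul, integral_centerMajorant (by linarith), mul_one_div]
  · rw [div_lt_one (by linarith)]; linarith

theorem lipschitzWith_field (hL : 0 ≤ L)
    (hfcL : ∀ x₁ x₂ y₁ y₂, ‖fc (x₁, y₁) - fc (x₂, y₂)‖ ≤ L * (‖x₁ - x₂‖ + ‖y₁ - y₂‖))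
    (hfsL : ∀ x₁ x₂ y₁ y₂, ‖fs (x₁, y₁) - fs (x₂, y₂)‖ ≤ L * (‖x₁ - x₂‖ + ‖y₁ - y₂‖))
    {ω : Ω} {t b : ℝ} (hb : ‖ε * z (θ t ω)‖ ≤ b) :
    LipschitzWith (Real.toNNReal (2 * (‖Ac‖ + ‖As‖ + 2 * L + 2 * b)))
      (field θ z ε Ac As fc fs ω t) := by
  have hb0 : 0 ≤ b := (norm_nonneg _).trans hb
  refine LipschitzWith.of_dist_le_mul fun u v => ?_
  rw [dist_eq_norm, dist_eq_norm, Real.coe_toNNReal _ (by positivity)]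
  refine (norm_le_sumNorm _).trans ?_
  have h1 := norm_center_rhs_sub_le (Ac := Ac) hfcL (ε * z (θ t ω)) u v
  have h2 := norm_stable_rhs_sub_le (As := As) hfsL (ε * z (θ t ω)) u v
  have h3 : sumNorm (field θ z ε Ac As fc fs ω t u - field θ z ε Ac As fc fs ω t v) ≤
      (‖Ac‖ + L) * sumNorm (u - v) + (‖As‖ + L) * sumNorm (u - v) + b * sumNorm (u - v) := by
    have e1 : (field θ z ε Ac As fc fs ω t u - field θ z ε Ac As fc fs ω t v).1 =
        ((Ac u.1 + rescale fc (ε * z (θ t ω)) u) - (Ac v.1 + rescale fc (ε * z (θ t ω)) v)) +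
          (ε * z (θ t ω)) • (u - v).1 := by
      simp only [field, Prod.fst_sub, smul_sub]; abel
    have e2 : (field θ z ε Ac As fc fs ω t u - field θ z ε Ac As fc fs ω t v).2 =
        ((As u.2 + rescale fs (ε * z (θ t ω)) u) - (As v.2 + rescale fs (ε * z (θ t ω)) v)) +
          (ε * z (θ t ω)) • (u - v).2 := by
      simp only [field, Prod.snd_sub, smul_sub]; abel
    have h4 : ‖(ε * z (θ t ω)) • (u - v).1‖ ≤ b * ‖(u - v).1‖ := by
      rw [norm_smul]; gcongr
    have h5 : ‖(ε * z (θ t ω)) • (u - v).2‖ ≤ b * ‖(u - v).2‖ := by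
      rw [norm_smul]; gcongr
    have h6 := norm_add_le ((Ac u.1 + rescale fc (ε * z (θ t ω)) u) -
      (Ac v.1 + rescale fc (ε * z (θ t ω)) v)) ((ε * z (θ t ω)) • (u - v).1)
    have h7 := norm_add_le ((As u.2 + rescale fs (ε * z (θ t ω)) u) -
      (As v.2 + rescale fs (ε * z (θ t ω)) v)) ((ε * z (θ t ω)) • (u - v).2)
    rw [sumNorm, e1, e2]
    have h8 : b * sumNorm (u - v) = b * ‖(u - v).1‖ + b * ‖(u - v).2‖ := mul_add _ _ _
    linarith
  refine h3.trans ?_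
  have h9 := sumNorm_le_two_mul_norm (u - v)
  have h10 := norm_nonneg (u - v)
  calc _ = (‖Ac‖ + ‖As‖ + 2 * L + b) * sumNorm (u - v) := by ring
    _ ≤ (‖Ac‖ + ‖As‖ + 2 * L + b) * (2 * ‖u - v‖) := by gcongr
    _ ≤ _ := by nlinarith

/-- The fixed point argument gives uniqueness only among curves of restricted growth. Here no growth
is assumed: paths of `z` are bounded on compact intervals, so the field is Lipschitz there uniformly
in time. -/
theorem field_solution_unique (hL : 0 ≤ L)
    (hfcL : ∀ x₁ x₂ y₁ y₂, ‖fc (x₁, y₁) - fc (x₂, y₂)‖ ≤ L * (‖x₁ - x₂‖ + ‖y₁ - y₂‖))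
    (hfsL : ∀ x₁ x₂ y₁ y₂, ‖fs (x₁, y₁) - fs (x₂, y₂)‖ ≤ L * (‖x₁ - x₂‖ + ‖y₁ - y₂‖))
    {ω : Ω} (hz : Continuous fun t => z (θ t ω)) {u v : ℝ → E n × E m}
    (hu : ∀ t, HasDerivAt u (field θ z ε Ac As fc fs ω t (u t)) t)
    (hv : ∀ t, HasDerivAt v (field θ z ε Ac As fc fs ω t (v t)) t) (h0 : u 0 = v 0) : u = v := by
  ext1 t
  have hT : 0 < |t| + 1 := by positivity
  obtain ⟨b, hb⟩ := (isCompact_Icc (a := -(|t| + 1)) (b := |t| + 1)).exists_bound_of_continuousOn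
    (continuous_const.mul hz : Continuous fun t => ε * z (θ t ω)).continuousOn
  refine ODE_solution_unique_of_mem_Ioo (s := fun _ => univ) (t₀ := 0)
    (v := field θ z ε Ac As fc fs ω) (a := -(|t| + 1)) (b := |t| + 1)
    (fun s hs => (lipschitzWith_field hL hfcL hfsL
      (hb s (Ioo_subset_Icc_self hs))).lipschitzOnWith) ⟨by linarith, hT⟩
    (fun s _ => ⟨hu s, mem_univ _⟩) (fun s _ => ⟨hv s, mem_univ _⟩) h0
    ⟨by linarith [neg_abs_le t], by linarith [le_abs_self t]⟩

theorem exists_solutionMap [MeasurableSpace Ω] (hθ : Measurable fun p : ℝ × Ω => θ p.1 p.2)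
    (hadd : ∀ s t ω, θ (s + t) ω = θ s (θ t ω))
    (hz : Measurable z) (hzc : ∀ ω, Continuous fun t => z (θ t ω))
    (hfc : Continuous fc) (hfs : Continuous fs) (hfc0 : fc 0 = 0) (hfs0 : fs 0 = 0)
    (hL : 0 ≤ L)
    (hfcL : ∀ x₁ x₂ y₁ y₂, ‖fc (x₁, y₁) - fc (x₂, y₂)‖ ≤ L * (‖x₁ - x₂‖ + ‖y₁ - y₂‖))
    (hfsL : ∀ x₁ x₂ y₁ y₂, ‖fs (x₁, y₁) - fs (x₂, y₂)‖ ≤ L * (‖x₁ - x₂‖ + ‖y₁ - y₂‖)) :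
    ∃ φ : ℝ → Ω → E n × E m → E n × E m,
      IsRDS θ φ ∧ IsSolutionMap (field θ z ε Ac As fc fs) φ := by
  set Λ : ℝ := (‖Ac‖ + L) + (‖As‖ + L) with hΛ
  have hΛ0 : 0 ≤ Λ := by rw [hΛ]; positivity
  have hh := isContractiveKernel_cauchy (ε := ε) hθ hz hzc hfc hfs hfc0 hfs0 hL hfcL hfsL hΛ
  let p : Ω × E n × E m → ℝ → E n × E m := fun a t =>
    (propagator θ z ε 0 a.1 0 t a.2.1, propagator θ z ε 0 a.1 0 t a.2.2)
  have hp : Measurable (Function.uncurry p) :=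
    (measurable_propagator hθ hz hzc (by fun_prop) measurable_const measurable_snd
      (by fun_prop)).prodMk (measurable_propagator hθ hz hzc (by fun_prop) measurable_const
        measurable_snd (by fun_prop))
  have hpC : ∀ a t, sumNorm (p a t) ≤ sumNorm a.2 * expWeight θ z ε (Λ + 1) a.1 t := by
    intro a t
    simp only [p, sumNorm, norm_propagator_zero_apply, expWeight]
    have h1 : 1 ≤ Real.exp ((Λ + 1) * |t|) := Real.one_le_exp (by positivity)
    have h2 := (Real.exp_pos (ε * ∫ r in (0 : ℝ)..t, z (θ r a.1))).le
    have h3 := sumNorm_nonneg a.2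
    rw [sumNorm] at h3
    nlinarith [mul_nonneg h2 h3]
  obtain ⟨φ, hφm, hφb, hφ⟩ := hh.exists_fixedPoint hp hpC
  have hφ1 : ∀ a, Measurable (φ a) := fun a => hφm.comp measurable_prodMk_left
  have hint := fun a t => hh.integrable_comp (hφ1 a) (hφb a) t
  have hI1 : ∀ a t, IntervalIntegrable (fun τ => propagator θ z ε 0 a.1 τ t
      (Ac (φ a τ).1 + rescale fc (ε * z (θ τ a.1)) (φ a τ))) volume 0 t := fun a t =>
    intervalIntegrable_of_signedIoc (hint a t).fst
  have hI2 : ∀ a t, IntervalIntegrable (fun τ => propagator θ z ε 0 a.1 τ t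
      (As (φ a τ).2 + rescale fs (ε * z (θ τ a.1)) (φ a τ))) volume 0 t := fun a t =>
    intervalIntegrable_of_signedIoc (hint a t).snd
  have he1 : ∀ a t, (φ a t).1 = propagator θ z ε 0 a.1 0 t a.2.1 +
      ∫ τ in (0 : ℝ)..t, propagator θ z ε 0 a.1 τ t
        (Ac (φ a τ).1 + rescale fc (ε * z (θ τ a.1)) (φ a τ)) := fun a t => by
    rw [← integral_signedIoc_smul]
    exact (congrArg Prod.fst (hφ a t)).trans (congrArg (_ + ·) (fst_integral (hint a t)))
  have he2 : ∀ a t, (φ a t).2 = propagator θ z ε 0 a.1 0 t a.2.2 +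
      ∫ τ in (0 : ℝ)..t, propagator θ z ε 0 a.1 τ t
        (As (φ a τ).2 + rescale fs (ε * z (θ τ a.1)) (φ a τ)) := fun a t => by
    rw [← integral_signedIoc_smul]
    exact (congrArg Prod.snd (hφ a t)).trans (congrArg (_ + ·) (snd_integral (hint a t)))
  have hc1 : ∀ a, Continuous fun t => (φ a t).1 := fun a => by
    rw [funext (he1 a)]
    exact continuous_duhamel (hzc a.1) a.2.1 (hI1 a)
  have hc2 : ∀ a, Continuous fun t => (φ a t).2 := fun a => by
    rw [funext (he2 a)]
    exact continuous_duhamel (hzc a.1) a.2.2 (hI2 a)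
  have hc : ∀ a, Continuous (φ a) := fun a => (hc1 a).prodMk (hc2 a)
  have hsol : ∀ a t, HasDerivAt (φ a) (field θ z ε Ac As fc fs a.1 t (φ a t)) t := by
    intro a t
    have hcr : ∀ {k : ℕ} {f : E n × E m → E k}, Continuous f →
        Continuous fun τ => rescale f (ε * z (θ τ a.1)) (φ a τ) := fun hf =>
      (continuous_rescale hf).comp ((continuous_const.mul (hzc a.1)).prodMk (hc a))
    have d1 : HasDerivAt (fun t => (φ a t).1) ((ε * z (θ t a.1)) • (φ a t).1 +
        (Ac (φ a t).1 + rescale fc (ε * z (θ t a.1)) (φ a t))) t := by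
      have := hasDerivAt_duhamel (A := 0) (ε := ε) (hzc a.1) a.2.1
        (F := fun τ => Ac (φ a τ).1 + rescale fc (ε * z (θ τ a.1)) (φ a τ))
        ((Ac.continuous.comp (hc1 a)).add (hcr hfc)) t
      rw [funext (he1 a)]
      refine this.congr_deriv ?_
      rw [← he1 a t, zero_apply, zero_add]
    have d2 : HasDerivAt (fun t => (φ a t).2) ((ε * z (θ t a.1)) • (φ a t).2 +
        (As (φ a t).2 + rescale fs (ε * z (θ t a.1)) (φ a t))) t := by
      have := hasDerivAt_duhamel (A := 0) (ε := ε) (hzc a.1) a.2.2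
        (F := fun τ => As (φ a τ).2 + rescale fs (ε * z (θ τ a.1)) (φ a τ))
        ((As.continuous.comp (hc2 a)).add (hcr hfs)) t
      rw [funext (he2 a)]
      refine this.congr_deriv ?_
      rw [← he2 a t, zero_apply, zero_add]
    refine (d1.prodMk d2).congr_deriv ?_
    simp only [field]
    exact Prod.ext (by simp only; abel) (by simp only; abel)
  have h0 : ∀ a, φ a 0 = a.2 := fun a =>
    Prod.ext
      (by rw [he1 a 0, intervalIntegral.integral_same, propagator_self, add_zero])
      (by rw [he2 a 0, intervalIntegral.integral_same, propagator_self, add_zero])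
  have hmap : IsSolutionMap (field θ z ε Ac As fc fs) fun t ω u => φ (ω, u) t := by
    intro ω u
    constructor
    · intro hu t
      exact congrFun (field_solution_unique hL hfcL hfsL (hzc ω) hu (hsol (ω, u 0))
        (h0 (ω, u 0)).symm) t
    · intro hu
      have hu' : u = φ (ω, u 0) := funext hu
      intro t
      have := hsol (ω, u 0) t
      rw [← hu'] at this
      exact this
  refine ⟨fun t ω u => φ (ω, u) t, ⟨?_, fun ω u => h0 (ω, u), fun t s ω u => ?_⟩, hmap⟩
  · exact hφm.comp (measurable_snd.prodMk measurable_fst)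
  -- The cocycle property is uniqueness applied to the shifted orbit, which solves the equation
  -- driven by `θ s ω`.
  · have := (hmap (θ s ω) fun t => φ (ω, u) (t + s)).1 (fun t => by
      have := (hsol (ω, u) (t + s)).comp_add_const t s
      simpa only [field, hadd] using this) t
    simpa using this

end SolutionMap

/-! ### The Lyapunov–Perron system -/

section LyapunovPerron

variable {Ω : Type*} {n m : ℕ} {θ : ℝ → Ω → Ω} {z : Ω → ℝ} {ε η : ℝ}
  {Ac : E n →L[ℝ] E n} {As : E m →L[ℝ] E m} {fc : E n × E m → E n} {fs : E n × E m → E m}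
  {L β γ K : ℝ}

/-- The integrand of the Lyapunov–Perron system. -/
def lyapunovPerronKernel (θ : ℝ → Ω → Ω) (z : Ω → ℝ) (ε : ℝ)
    (Ac : E n →L[ℝ] E n) (As : E m →L[ℝ] E m) (fc : E n × E m → E n) (fs : E n × E m → E m)
    (ω : Ω) (t τ : ℝ) (u : E n × E m) : E n × E m :=
  (signedIoc t τ • propagator θ z ε Ac ω τ t (rescale fc (ε * z (θ τ ω)) u),
   (Iic t).indicator (fun τ => propagator θ z ε As ω τ t (rescale fs (ε * z (θ τ ω)) u)) τ)

/-- A measurable flow and a variable with continuous paths along it, with a linear part that has an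
exponential trichotomy without unstable part and a Lipschitz nonlinearity under the gap
condition. -/
structure IsGapSystem [MeasurableSpace Ω] (θ : ℝ → Ω → Ω) (z : Ω → ℝ) (η : ℝ)
    (Ac : E n →L[ℝ] E n) (As : E m →L[ℝ] E m) (fc : E n × E m → E n) (fs : E n × E m → E m)
    (L β γ K : ℝ) : Prop where
  measurable_flow : Measurable fun p : ℝ × Ω => θ p.1 p.2
  flow_add : ∀ s t ω, θ (s + t) ω = θ s (θ t ω)
  measurable_path : Measurable z
  continuous_path : ∀ ω, Continuous fun t => z (θ t ω)
  continuous_center : Continuous fc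
  continuous_stable : Continuous fs
  center_zero : fc 0 = 0
  stable_zero : fs 0 = 0
  lipschitz_nonneg : 0 ≤ L
  center_lipschitz :
    ∀ x₁ x₂ y₁ y₂, ‖fc (x₁, y₁) - fc (x₂, y₂)‖ ≤ L * (‖x₁ - x₂‖ + ‖y₁ - y₂‖)
  stable_lipschitz :
    ∀ x₁ x₂ y₁ y₂, ‖fs (x₁, y₁) - fs (x₂, y₂)‖ ≤ L * (‖x₁ - x₂‖ + ‖y₁ - y₂‖)
  rate_nonneg : 0 ≤ γ
  const_pos : 0 < K
  center_bound :
    ∀ (t : ℝ) (x : E n), ‖NormedSpace.exp (t • Ac) x‖ ≤ K * Real.exp (γ * |t|) * ‖x‖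
  stable_bound : ∀ t : ℝ, 0 ≤ t → ∀ y : E m,
    ‖NormedSpace.exp (t • As) y‖ ≤ K * Real.exp (-β * t) * ‖y‖
  center_lt : γ < η
  lt_stable : η < β
  gap : K * L / (η - γ) + K * L / (β - η) < 1

/-- The random exponent is additive along the flow and `|t + s| ≤ |t| + |s|`, so the weighted space
is stable under time shifts. -/
theorem expWeight_add_le (hadd : ∀ s t ω, θ (s + t) ω = θ s (θ t ω)) {ω : Ω}
    (hz : Continuous fun t => z (θ t ω)) (hη : 0 ≤ η) (s t : ℝ) :
    expWeight θ z ε η ω (t + s) ≤ expWeight θ z ε η ω s * expWeight θ z ε η (θ s ω) t := by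
  have h1 : ∫ r in (0 : ℝ)..t, z (θ r (θ s ω)) = ∫ r in s..(t + s), z (θ r ω) := by
    simp only [← hadd]
    rw [intervalIntegral.integral_comp_add_right (fun r => z (θ r ω)) s, zero_add]
  have h2 := intervalIntegral.integral_add_adjacent_intervals
    (hz.intervalIntegrable (μ := volume) 0 s) (hz.intervalIntegrable s (t + s))
  have h3 := mul_le_mul_of_nonneg_left (abs_add_le t s) hη
  simp only [expWeight, ← Real.exp_add, Real.exp_le_exp, h1, ← h2]
  linarith

theorem continuous_rescale_flow {k : ℕ} {f : E n × E m → E k} (hf : Continuous f) {ω : Ω}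
    (hz : Continuous fun t => z (θ t ω)) {u : ℝ → E n × E m} (hu : Continuous u) :
    Continuous fun τ => rescale f (ε * z (θ τ ω)) (u τ) :=
  (continuous_rescale hf).comp ((continuous_const.mul hz).prodMk hu)

namespace IsLyapunovPerronSolution

variable {ω : Ω} {ξ : E n} {X : ℝ → E n} {Y : ℝ → E m}

theorem center_zero (h : IsLyapunovPerronSolution θ z ε η Ac As fc fs ω ξ X Y) : X 0 = ξ := by
  rw [h.eqX 0, intervalIntegral.integral_same, propagator_self, add_zero]

theorem stable_eq_duhamel (h : IsLyapunovPerronSolution θ z ε η Ac As fc fs ω ξ X Y)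
    (hz : Continuous fun t => z (θ t ω)) (t : ℝ) :
    Y t = propagator θ z ε As ω 0 t (Y 0) +
      ∫ τ in (0 : ℝ)..t, propagator θ z ε As ω τ t (rescale fs (ε * z (θ τ ω)) (X τ, Y τ)) := by
  rw [h.eqY t, h.eqY 0]
  exact integral_past_eq_duhamel hz (F := fun τ => rescale fs (ε * z (θ τ ω)) (X τ, Y τ))
    h.integrableY t

theorem hasDerivAt (h : IsLyapunovPerronSolution θ z ε η Ac As fc fs ω ξ X Y)
    (hz : Continuous fun t => z (θ t ω)) (hfc : Continuous fc) (hfs : Continuous fs) (t : ℝ) :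
    HasDerivAt (fun t => (X t, Y t)) (field θ z ε Ac As fc fs ω t (X t, Y t)) t := by
  have hu : Continuous fun t => (X t, Y t) := h.memX.1.prodMk h.memY.1
  have d1 := hasDerivAt_duhamel (A := Ac) (ε := ε) hz ξ
    (continuous_rescale_flow (ε := ε) hfc hz hu) t
  have d2 := hasDerivAt_duhamel (A := As) (ε := ε) hz (Y 0)
    (continuous_rescale_flow (ε := ε) hfs hz hu) t
  rw [← h.eqX t, ← funext h.eqX] at d1
  rw [← h.stable_eq_duhamel hz t, ← funext (h.stable_eq_duhamel hz)] at d2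
  exact d1.prodMk d2

theorem memWeighted_shift {k : ℕ} {x : ℝ → E k} (hx : MemWeighted θ z ε η ω x)
    (hadd : ∀ s t ω, θ (s + t) ω = θ s (θ t ω)) (hz : Continuous fun t => z (θ t ω))
    (hη : 0 ≤ η) (s : ℝ) : MemWeighted θ z ε η (θ s ω) fun t => x (t + s) := by
  rw [memWeighted_iff] at hx ⊢
  obtain ⟨hc, C, hC⟩ := hx
  refine ⟨hc.comp (continuous_id.add continuous_const), C * expWeight θ z ε η ω s, fun t => ?_⟩
  have hC0 : 0 ≤ C := nonneg_of_mul_nonneg_left ((norm_nonneg _).trans (hC 0)) (expWeight_pos _ _)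
  refine (hC (t + s)).trans ?_
  rw [mul_assoc]
  exact mul_le_mul_of_nonneg_left (expWeight_add_le hadd hz hη s t) hC0

/-- The source of invariance. The center equation restarts at time `s` from `X s`, and the stable
equation, integrating over the whole past, has no distinguished initial time. -/
theorem shift (h : IsLyapunovPerronSolution θ z ε η Ac As fc fs ω ξ X Y)
    (hadd : ∀ s t ω, θ (s + t) ω = θ s (θ t ω)) (hz : Continuous fun t => z (θ t ω))
    (hfc : Continuous fc) (hη : 0 ≤ η) (s : ℝ) :
    IsLyapunovPerronSolution θ z ε η Ac As fc fs (θ s ω) (X s)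
      (fun t => X (t + s)) (fun t => Y (t + s)) := by
  have hpre : ∀ t : ℝ, (fun x : ℝ => x + s) ⁻¹' Iic (t + s) = Iic t := fun t => by ext x; simp
  have hmp := measurePreserving_add_right (volume : Measure ℝ) s
  have hemb := measurableEmbedding_addRight s
  refine ⟨memWeighted_shift h.memX hadd hz hη s, memWeighted_shift h.memY hadd hz hη s,
    fun t => ?_, fun t => ?_, fun t => ?_⟩
  · simp only [propagator_flow hadd, ← hadd]
    rw [intervalIntegral.integral_comp_add_right (fun τ =>
      propagator θ z ε Ac ω τ (t + s) (rescale fc (ε * z (θ τ ω)) (X τ, Y τ))) s, zero_add,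
      h.eqX s, duhamel_restart hz ξ
        (continuous_rescale_flow (ε := ε) hfc hz (h.memX.1.prodMk h.memY.1)) s (t + s)]
    exact h.eqX (t + s)
  · have := (hmp.integrableOn_comp_preimage hemb).2 (h.integrableY (t + s))
    rw [hpre] at this
    simp only [propagator_flow hadd, ← hadd]
    exact this
  · simp only [propagator_flow hadd, ← hadd]
    rw [h.eqY (t + s), ← hmp.setIntegral_preimage_emb hemb _ (Iic (t + s)), hpre]

end IsLyapunovPerronSolution

namespace IsGapSystem

variable [MeasurableSpace Ω]

theorem weight_nonneg (hS : IsGapSystem θ z η Ac As fc fs L β γ K) : 0 ≤ η :=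
  hS.rate_nonneg.trans hS.center_lt.le

/-- Each component contributes one term of the gap condition: the center part decays relative to the
weight at rate `η - γ`, the stable part at rate `β - η`. -/
theorem isContractiveKernel (hS : IsGapSystem θ z η Ac As fc fs L β γ K) :
    IsContractiveKernel
      (fun a : Ω × E n => lyapunovPerronKernel θ z ε Ac As fc fs a.1)
      (fun a => expWeight θ z ε η a.1)
      (fun t τ => K * L * centerMajorant (η - γ) t τ + K * L * stableMajorant (β - η) t τ)
      (K * L / (η - γ) + K * L / (β - η)) := by
  have hK := hS.const_pos.le
  have hL := hS.lipschitz_nonneg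
  have hγ := sub_pos.2 hS.center_lt
  have hβ := sub_pos.2 hS.lt_stable
  have hI1 := fun t => (integrable_centerMajorant hγ t).const_mul (K * L)
  have hI2 := fun t => (integrable_stableMajorant hβ t).const_mul (K * L)
  refine
    { measurable := ?_
      weight_pos := fun a t => expWeight_pos _ _
      map_zero := fun a t τ => by
        simp [lyapunovPerronKernel, rescale_zero, hS.center_zero, hS.stable_zero]
      lipschitz := fun a t τ u v => ?_
      nonneg := fun t τ => add_nonneg
        (mul_nonneg (mul_nonneg hK hL) (centerMajorant_nonneg _ _ _))
        (mul_nonneg (mul_nonneg hK hL) (stableMajorant_nonneg _ _ _))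
      integrable := fun t => (hI1 t).add (hI2 t)
      integral_le := fun t => ?_
      lt_one := hS.gap }
  · have hω : Measurable fun q : ((Ω × E n) × ℝ) × ℝ × E n × E m => q.1.1.1 := by fun_prop
    have hτ : Measurable fun q : ((Ω × E n) × ℝ) × ℝ × E n × E m => q.2.1 := by fun_prop
    have ht : Measurable fun q : ((Ω × E n) × ℝ) × ℝ × E n × E m => q.1.2 := by fun_prop
    have hu : Measurable fun q : ((Ω × E n) × ℝ) × ℝ × E n × E m => q.2.2 := by fun_prop
    refine Measurable.prodMk ((measurable_signedIoc.comp (ht.prodMk hτ)).smul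
      (measurable_propagator hS.measurable_flow hS.measurable_path hS.continuous_path hω hτ ht
        (measurable_rescale_flow hS.measurable_flow hS.measurable_path hS.continuous_center
          hω hτ hu))) ?_
    exact Measurable.indicator
      (s := {q : ((Ω × E n) × ℝ) × ℝ × E n × E m | q.2.1 ≤ q.1.2})
      (measurable_propagator hS.measurable_flow hS.measurable_path hS.continuous_path hω hτ ht
        (measurable_rescale_flow hS.measurable_flow hS.measurable_path hS.continuous_stable
          hω hτ hu)) (measurableSet_le hτ ht)
  · obtain ⟨ω, ξ⟩ := a
    have hN := sumNorm_nonneg (u - v)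
    set N := sumNorm (u - v) with hNdef
    set e := Real.exp (ε * ∫ r in τ..t, z (θ r ω)) with he
    set e₀ := Real.exp (ε * ∫ r in (0 : ℝ)..t, z (θ r ω)) with he₀
    have he0 : 0 ≤ e := (Real.exp_pos _).le
    have he00 : 0 ≤ e₀ := (Real.exp_pos _).le
    have h2 : e * expWeight θ z ε η ω τ = e₀ * Real.exp (η * |τ|) :=
      exp_integral_mul_expWeight (hS.continuous_path ω) τ t
    have hwpos := (expWeight_pos (θ := θ) (z := z) (ε := ε) (η := η) ω τ).le
    have hc : ‖(lyapunovPerronKernel θ z ε Ac As fc fs ω t τ u -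
        lyapunovPerronKernel θ z ε Ac As fc fs ω t τ v).1‖ * expWeight θ z ε η ω τ ≤
        expWeight θ z ε η ω t * (K * L * centerMajorant (η - γ) t τ) * N := by
      have h1 : ‖(lyapunovPerronKernel θ z ε Ac As fc fs ω t τ u -
          lyapunovPerronKernel θ z ε Ac As fc fs ω t τ v).1‖ ≤
          |signedIoc t τ| * (e * (K * Real.exp (γ * |t - τ|) * (L * N))) := by
        simp only [lyapunovPerronKernel, Prod.fst_sub, ← smul_sub, ← map_sub, norm_smul,
          Real.norm_eq_abs, norm_propagator_apply]
        gcongr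
        exact (hS.center_bound _ _).trans (mul_le_mul_of_nonneg_left
          (norm_rescale_sub_le hS.center_lipschitz _ u v) (by positivity))
      calc _ ≤ |signedIoc t τ| * (e * (K * Real.exp (γ * |t - τ|) * (L * N))) *
            expWeight θ z ε η ω τ := mul_le_mul_of_nonneg_right h1 hwpos
        _ = |signedIoc t τ| * (K * Real.exp (γ * |t - τ|) * (L * N)) *
            (e * expWeight θ z ε η ω τ) := by ring
        _ = e₀ * (K * L * N) *
            (|signedIoc t τ| * Real.exp (γ * |t - τ|) * Real.exp (η * |τ|)) := by rw [h2]; ring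
        _ ≤ e₀ * (K * L * N) * (Real.exp (η * |t|) * centerMajorant (η - γ) t τ) :=
          mul_le_mul_of_nonneg_left (abs_signedIoc_mul_le γ η t τ) (by positivity)
        _ = _ := by rw [expWeight]; ring
    have hs : ‖(lyapunovPerronKernel θ z ε Ac As fc fs ω t τ u -
        lyapunovPerronKernel θ z ε Ac As fc fs ω t τ v).2‖ * expWeight θ z ε η ω τ ≤
        expWeight θ z ε η ω t * (K * L * stableMajorant (β - η) t τ) * N := by
      by_cases hτ : τ ≤ t
      · have h1 : ‖(lyapunovPerronKernel θ z ε Ac As fc fs ω t τ u -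
            lyapunovPerronKernel θ z ε Ac As fc fs ω t τ v).2‖ ≤
            e * (K * Real.exp (-β * (t - τ)) * (L * N)) := by
          simp only [lyapunovPerronKernel, Prod.snd_sub, indicator_of_mem (mem_Iic.2 hτ),
            ← map_sub, norm_propagator_apply]
          gcongr
          exact (hS.stable_bound _ (sub_nonneg.2 hτ) _).trans (mul_le_mul_of_nonneg_left
            (norm_rescale_sub_le hS.stable_lipschitz _ u v) (by positivity))
        calc _ ≤ e * (K * Real.exp (-β * (t - τ)) * (L * N)) *
              expWeight θ z ε η ω τ := mul_le_mul_of_nonneg_right h1 hwpos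
          _ = K * Real.exp (-β * (t - τ)) * (L * N) * (e * expWeight θ z ε η ω τ) := by ring
          _ = e₀ * (K * L * N) * (Real.exp (-β * (t - τ)) * Real.exp (η * |τ|)) := by
            rw [h2]; ring
          _ ≤ e₀ * (K * L * N) * (Real.exp (η * |t|) * stableMajorant (β - η) t τ) :=
            mul_le_mul_of_nonneg_left (exp_mul_exp_abs_le hS.weight_nonneg hτ) (by positivity)
          _ = _ := by rw [expWeight]; ring
      · have hτ' : τ ∉ Iic t := hτ
        simp [lyapunovPerronKernel, stableMajorant, hτ']
    rw [sumNorm, add_mul, mul_add, add_mul]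
    exact add_le_add hc hs
  · rw [integral_add (hI1 t) (hI2 t), integral_const_mul, integral_const_mul,
      integral_centerMajorant hγ, integral_stableMajorant hβ, mul_one_div, mul_one_div]

/-- The linear part of the Lyapunov–Perron system. -/
def _root_.RandomCenterManifold.lyapunovPerronLinear (θ : ℝ → Ω → Ω) (z : Ω → ℝ) (ε : ℝ)
    (Ac : E n →L[ℝ] E n) (m : ℕ) (ω : Ω) (ξ : E n) (t : ℝ) : E n × E m :=
  (propagator θ z ε Ac ω 0 t ξ, 0)

theorem sumNorm_linear_sub_le (hS : IsGapSystem θ z η Ac As fc fs L β γ K) (ω : Ω) (ξ ξ' : E n)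
    (t : ℝ) : sumNorm (lyapunovPerronLinear θ z ε Ac m ω ξ t -
      lyapunovPerronLinear θ z ε Ac m ω ξ' t) ≤ K * ‖ξ - ξ'‖ * expWeight θ z ε η ω t := by
  simp only [lyapunovPerronLinear, sumNorm, Prod.fst_sub, Prod.snd_sub, sub_self, norm_zero,
    add_zero, ← map_sub, norm_propagator_apply, sub_zero, expWeight]
  have h1 := hS.center_bound t (ξ - ξ')
  have h2 : Real.exp (γ * |t|) ≤ Real.exp (η * |t|) :=
    Real.exp_le_exp.2 (mul_le_mul_of_nonneg_right hS.center_lt.le (abs_nonneg t))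
  have h3 : K * Real.exp (γ * |t|) * ‖ξ - ξ'‖ ≤ K * Real.exp (η * |t|) * ‖ξ - ξ'‖ := by
    have := hS.const_pos.le
    gcongr
  refine (mul_le_mul_of_nonneg_left (h1.trans h3) (Real.exp_pos _).le).trans_eq ?_
  ring

theorem fixedPoint_of_isLyapunovPerronSolution (hS : IsGapSystem θ z η Ac As fc fs L β γ K)
    {ω : Ω} {ξ : E n} {X : ℝ → E n} {Y : ℝ → E m}
    (h : IsLyapunovPerronSolution θ z ε η Ac As fc fs ω ξ X Y) :
    Measurable (fun t => (X t, Y t)) ∧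
      (∃ C, ∀ t, sumNorm (X t, Y t) ≤ C * expWeight θ z ε η ω t) ∧
      ∀ t, (X t, Y t) = lyapunovPerronLinear θ z ε Ac m ω ξ t +
        ∫ τ, lyapunovPerronKernel θ z ε Ac As fc fs ω t τ (X τ, Y τ) := by
  obtain ⟨hX, C, hC⟩ := memWeighted_iff.1 h.memX
  obtain ⟨hY, C', hC'⟩ := memWeighted_iff.1 h.memY
  have hm : Measurable fun t => (X t, Y t) := (hX.prodMk hY).measurable
  have hb : ∀ t, sumNorm (X t, Y t) ≤ (C + C') * expWeight θ z ε η ω t := fun t => by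
    rw [add_mul]; exact add_le_add (hC t) (hC' t)
  refine ⟨hm, ⟨C + C', hb⟩, fun t => ?_⟩
  have hi := (hS.isContractiveKernel (ε := ε)).integrable_comp (a := (ω, ξ)) hm hb t
  refine Prod.ext ?_ ?_
  · rw [Prod.fst_add, fst_integral hi]
    simp only [lyapunovPerronKernel, lyapunovPerronLinear]
    rw [integral_signedIoc_smul]
    exact h.eqX t
  · rw [Prod.snd_add, snd_integral hi]
    simp only [lyapunovPerronLinear, zero_add]
    refine (h.eqY t).trans ?_
    rw [← integral_indicator measurableSet_Iic]
    rfl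

/-- The point beyond splitting components is continuity of a merely measurable fixed point, which
comes from `continuous_duhamel`. -/
theorem isLyapunovPerronSolution_of_fixedPoint (hS : IsGapSystem θ z η Ac As fc fs L β γ K)
    {ω : Ω} {ξ : E n} {u : ℝ → E n × E m} (hm : Measurable u) {C : ℝ}
    (hb : ∀ t, sumNorm (u t) ≤ C * expWeight θ z ε η ω t)
    (hu : ∀ t, u t = lyapunovPerronLinear θ z ε Ac m ω ξ t +
        ∫ τ, lyapunovPerronKernel θ z ε Ac As fc fs ω t τ (u τ)) :
    IsLyapunovPerronSolution θ z ε η Ac As fc fs ω ξ (fun t => (u t).1) (fun t => (u t).2) := by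
  have hz := hS.continuous_path ω
  have hi := fun t => (hS.isContractiveKernel (ε := ε)).integrable_comp (a := (ω, ξ)) hm hb t
  have hiX : ∀ t, IntervalIntegrable (fun τ => propagator θ z ε Ac ω τ t
      (rescale fc (ε * z (θ τ ω)) (u τ))) volume 0 t := fun t =>
    intervalIntegrable_of_signedIoc (hi t).fst
  have hiY : ∀ t, IntegrableOn (fun τ => propagator θ z ε As ω τ t
      (rescale fs (ε * z (θ τ ω)) (u τ))) (Iic t) := fun t =>
    (integrable_indicator_iff measurableSet_Iic).1 (hi t).snd
  have heX : ∀ t, (u t).1 = propagator θ z ε Ac ω 0 t ξ + ∫ τ in (0 : ℝ)..t,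
      propagator θ z ε Ac ω τ t (rescale fc (ε * z (θ τ ω)) (u τ)) := fun t => by
    rw [← integral_signedIoc_smul]
    exact (congrArg Prod.fst (hu t)).trans (congrArg (_ + ·) (fst_integral (hi t)))
  have heY : ∀ t, (u t).2 = ∫ τ in Iic t,
      propagator θ z ε As ω τ t (rescale fs (ε * z (θ τ ω)) (u τ)) := fun t => by
    rw [← integral_indicator measurableSet_Iic]
    refine (congrArg Prod.snd (hu t)).trans ((zero_add _).trans ?_)
    exact snd_integral (hi t)
  -- The integral over the past is rewritten from the initial value at time `0`, the form in which
  -- continuity is available.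
  have heY' : ∀ t, (u t).2 = propagator θ z ε As ω 0 t (u 0).2 + ∫ τ in (0 : ℝ)..t,
      propagator θ z ε As ω τ t (rescale fs (ε * z (θ τ ω)) (u τ)) := fun t => by
    rw [heY t, heY 0]
    exact integral_past_eq_duhamel hz (F := fun τ => rescale fs (ε * z (θ τ ω)) (u τ)) hiY t
  have hiY' : ∀ t, IntervalIntegrable (fun τ => propagator θ z ε As ω τ t
      (rescale fs (ε * z (θ τ ω)) (u τ))) volume 0 t := fun t => by
    have h0 := (propagator θ z ε As ω 0 t).integrable_comp (hiY 0)
    simp only [propagator_propagator hz] at h0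
    have h1 : IntegrableOn (fun τ => propagator θ z ε As ω τ t
        (rescale fs (ε * z (θ τ ω)) (u τ))) (Iic 0) := h0
    exact ⟨(hiY t).mono_set Ioc_subset_Iic_self, h1.mono_set Ioc_subset_Iic_self⟩
  refine ⟨memWeighted_iff.2 ⟨?_, C, fun t => ?_⟩, memWeighted_iff.2 ⟨?_, C, fun t => ?_⟩,
    heX, hiY, heY⟩
  · rw [funext heX]
    exact continuous_duhamel hz ξ hiX
  · exact (le_add_of_nonneg_right (norm_nonneg _)).trans (hb t)
  · rw [funext heY']
    exact continuous_duhamel hz _ hiY'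
  · exact (le_add_of_nonneg_left (norm_nonneg _)).trans (hb t)

/-- Gives both uniqueness, at `ξ = ξ'`, and the Lipschitz constant of the manifold, at `t = 0`,
where the weight is `1`. -/
theorem isLyapunovPerronSolution_sub_le (hS : IsGapSystem θ z η Ac As fc fs L β γ K)
    {ω : Ω} {ξ ξ' : E n} {X X' : ℝ → E n} {Y Y' : ℝ → E m}
    (h : IsLyapunovPerronSolution θ z ε η Ac As fc fs ω ξ X Y)
    (h' : IsLyapunovPerronSolution θ z ε η Ac As fc fs ω ξ' X' Y') (t : ℝ) :
    sumNorm ((X t, Y t) - (X' t, Y' t)) ≤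
      K * ‖ξ - ξ'‖ / (1 - (K * L / (η - γ) + K * L / (β - η))) * expWeight θ z ε η ω t := by
  obtain ⟨hm, ⟨C, hb⟩, he⟩ := hS.fixedPoint_of_isLyapunovPerronSolution h
  obtain ⟨hm', ⟨C', hb'⟩, he'⟩ := hS.fixedPoint_of_isLyapunovPerronSolution h'
  exact (hS.isContractiveKernel (ε := ε)).sumNorm_fixedPoint_sub_le (a := (ω, ξ)) hm hm' hb hb'
    he he' (hS.sumNorm_linear_sub_le ω ξ ξ') t

theorem isLyapunovPerronSolution_unique (hS : IsGapSystem θ z η Ac As fc fs L β γ K)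
    {ω : Ω} {ξ : E n} {X X' : ℝ → E n} {Y Y' : ℝ → E m}
    (h : IsLyapunovPerronSolution θ z ε η Ac As fc fs ω ξ X Y)
    (h' : IsLyapunovPerronSolution θ z ε η Ac As fc fs ω ξ X' Y') : X = X' ∧ Y = Y' := by
  have h1 : ∀ t, (X t, Y t) = (X' t, Y' t) := fun t => by
    have := (norm_le_sumNorm _).trans (hS.isLyapunovPerronSolution_sub_le h h' t)
    rw [sub_self, norm_zero, mul_zero, zero_div, zero_mul] at this
    exact sub_eq_zero.1 (norm_le_zero_iff.1 this)
  exact ⟨funext fun t => congrArg Prod.fst (h1 t), funext fun t => congrArg Prod.snd (h1 t)⟩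

/-- The solutions of the Lyapunov–Perron system exist and depend measurably on `ω` and `ξ`. -/
theorem exists_isLyapunovPerronSolution (hS : IsGapSystem θ z η Ac As fc fs L β γ K) (ε : ℝ) :
    ∃ u : Ω × E n → ℝ → E n × E m, Measurable (Function.uncurry u) ∧ ∀ ω ξ,
      IsLyapunovPerronSolution θ z ε η Ac As fc fs ω ξ
        (fun t => (u (ω, ξ) t).1) (fun t => (u (ω, ξ) t).2) := by
  have hp : Measurable (Function.uncurry
      fun (a : Ω × E n) t => lyapunovPerronLinear θ z ε Ac m a.1 a.2 t) :=
    (measurable_propagator hS.measurable_flow hS.measurable_path hS.continuous_path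
      (by fun_prop) measurable_const measurable_snd (by fun_prop)).prodMk measurable_const
  obtain ⟨u, hum, hub, hu⟩ := (hS.isContractiveKernel (ε := ε)).exists_fixedPoint hp
    (C := fun a => K * ‖a.2‖) fun a t => by
      simpa [lyapunovPerronLinear] using hS.sumNorm_linear_sub_le (ε := ε) a.1 a.2 0 t
  exact ⟨u, hum, fun ω ξ => hS.isLyapunovPerronSolution_of_fixedPoint
    (hum.comp measurable_prodMk_left) (hub (ω, ξ)) (hu (ω, ξ))⟩

theorem isLyapunovPerronSolution_zero (hS : IsGapSystem θ z η Ac As fc fs L β γ K) (ω : Ω) :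
    IsLyapunovPerronSolution θ z ε η Ac As fc fs ω 0 (fun _ => 0) (fun _ => 0) :=
  hS.isLyapunovPerronSolution_of_fixedPoint (u := fun _ => 0) (C := 0) measurable_const
    (fun t => by simp) fun t => by
      have : ∀ τ, lyapunovPerronKernel θ z ε Ac As fc fs ω t τ 0 = 0 := fun τ =>
        (hS.isContractiveKernel (ε := ε)).map_zero (ω, 0) t τ
      simp [this, lyapunovPerronLinear]
      rfl

end IsGapSystem

end LyapunovPerron

/-! ### The graph, its invariance and its tangency -/

section CenterManifold

theorem isClosed_graph {n m : ℕ} {h : E n → E m} (hh : Continuous h) : IsClosed (graph h) :=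
  isClosed_eq continuous_snd (hh.comp continuous_fst)

/-- By continuity of `H ω`, a graph point within distance `r` of `x` may be taken over a fixed
countable dense set of `ξ`, which makes the distance measurable. -/
theorem isRandomSet_graph {Ω : Type*} [MeasurableSpace Ω] {n m : ℕ} {H : Ω → E n → E m}
    (hm : ∀ ξ, Measurable fun ω => H ω ξ) (hc : ∀ ω, Continuous (H ω)) :
    IsRandomSet fun ω => graph (H ω) := by
  have hne : ∀ ω, (graph (H ω)).Nonempty := fun ω => ⟨(0, H ω 0), rfl⟩
  refine ⟨hne, fun ω => isClosed_graph (hc ω), fun x => measurable_of_Iio fun r => ?_⟩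
  have he : (fun ω => Metric.infDist x (graph (H ω))) ⁻¹' Iio r =
      ⋃ i, {ω | dist x (TopologicalSpace.denseSeq (E n) i,
        H ω (TopologicalSpace.denseSeq (E n) i)) < r} := by
    ext ω
    rw [mem_preimage, mem_Iio, Metric.infDist_lt_iff (hne ω), mem_iUnion]
    constructor
    · rintro ⟨⟨ξ, y⟩, hy, hlt⟩
      obtain rfl : y = H ω ξ := hy
      have hopen : IsOpen {ξ | dist x (ξ, H ω ξ) < r} :=
        isOpen_lt (continuous_const.dist (continuous_id.prodMk (hc ω))) continuous_const
      exact (TopologicalSpace.denseRange_denseSeq (E n)).exists_mem_open hopen ⟨ξ, hlt⟩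
    · rintro ⟨i, hi⟩
      exact ⟨_, rfl, hi⟩
  rw [he]
  exact MeasurableSet.iUnion fun i =>
    measurableSet_lt (measurable_const.dist (measurable_const.prodMk (hm _))) measurable_const

theorem rescale_isLittleO {n m k : ℕ} {f : E n × E m → E k} (hf : HasFDerivAt f
    (0 : E n × E m →L[ℝ] E k) 0) (hf0 : f 0 = 0) (c : ℝ) :
    rescale f c =o[𝓝 0] (id : E n × E m → E n × E m) := by
  have h1 : f =o[𝓝 0] (id : E n × E m → E n × E m) := by
    have := hasFDerivAt_iff_isLittleO_nhds_zero.1 hf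
    simp only [zero_add, hf0, sub_zero, zero_apply] at this
    exact this
  have ht : Tendsto (fun u : E n × E m => Real.exp c • u) (𝓝 0) (𝓝 0) := by
    have : Continuous fun u : E n × E m => Real.exp c • u := continuous_const_smul _
    simpa using this.tendsto 0
  have h2 : (fun u : E n × E m => Real.exp c • u) =O[𝓝 0] (id : E n × E m → E n × E m) :=
    Asymptotics.IsBigO.of_bound (Real.exp c) (Eventually.of_forall fun u => by
      rw [norm_smul, Real.norm_of_nonneg (Real.exp_pos c).le]; rfl)
  exact ((h1.comp_tendsto ht).trans_isBigO h2).const_smul_left (Real.exp (-c))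

variable {Ω : Type*} [MeasurableSpace Ω] {n m : ℕ} {θ : ℝ → Ω → Ω} {z : Ω → ℝ} {ε η : ℝ}
  {Ac : E n →L[ℝ] E n} {As : E m →L[ℝ] E m} {fc : E n × E m → E n} {fs : E n × E m → E m}
  {L β γ K : ℝ}

namespace IsGapSystem

/-- No differentiability of `ξ ↦ (X ξ, Y ξ)` is needed. Solutions are `O(‖ξ‖)` at each time and `fs`
is `o(‖u‖)`, so the integrand for `Y ξ 0`, divided by `‖ξ‖`, tends to zero pointwise, with an
integrable majorant. -/
theorem hasFDerivAt_zero (hS : IsGapSystem θ z η Ac As fc fs L β γ K)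
    (hfs : HasFDerivAt fs (0 : E n × E m →L[ℝ] E m) 0) {ω : Ω} {X : E n → ℝ → E n}
    {Y : E n → ℝ → E m}
    (h : ∀ ξ, IsLyapunovPerronSolution θ z ε η Ac As fc fs ω ξ (X ξ) (Y ξ)) :
    HasFDerivAt (fun ξ => Y ξ 0) (0 : E n →L[ℝ] E m) 0 := by
  have hh := hS.isContractiveKernel (ε := ε)
  set κ := K * L / (η - γ) + K * L / (β - η) with hκ
  set C := K / (1 - κ) with hC
  have hCnn : 0 ≤ C := div_nonneg hS.const_pos.le (sub_nonneg.2 hS.gap.le)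
  -- The zero curve solves the system for `ξ = 0`; the Lipschitz estimate against it gives a bound
  -- linear in `‖ξ‖`.
  have hb : ∀ ξ τ, sumNorm (X ξ τ, Y ξ τ) ≤ C * ‖ξ‖ * expWeight θ z ε η ω τ := fun ξ τ => by
    have := hS.isLyapunovPerronSolution_sub_le (h ξ) (hS.isLyapunovPerronSolution_zero ω) τ
    have e : ((X ξ τ, Y ξ τ) : E n × E m) - (0, 0) = (X ξ τ, Y ξ τ) := sub_zero _
    rw [e, sub_zero] at this
    refine this.trans_eq ?_
    rw [hC, mul_div_right_comm]
  set M : ℝ → ℝ := fun τ =>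
    K * L * centerMajorant (η - γ) 0 τ + K * L * stableMajorant (β - η) 0 τ with hM
  set G : E n → ℝ → E m := fun ξ τ =>
    (lyapunovPerronKernel θ z ε Ac As fc fs ω 0 τ (X ξ τ, Y ξ τ)).2 with hG
  have hm : ∀ ξ, Measurable fun τ => (X ξ τ, Y ξ τ) := fun ξ =>
    (hS.fixedPoint_of_isLyapunovPerronSolution (h ξ)).1
  have hGm : ∀ ξ, Measurable (G ξ) := fun ξ =>
    (hh.measurable_section (ω, ξ) 0 (hm ξ)).snd
  have hGb : ∀ ξ τ, ‖G ξ τ‖ / ‖ξ‖ ≤ C * M τ := fun ξ τ => by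
    have h1 : ‖G ξ τ‖ ≤ sumNorm (lyapunovPerronKernel θ z ε Ac As fc fs ω 0 τ (X ξ τ, Y ξ τ)) :=
      le_add_of_nonneg_left (norm_nonneg _)
    have h2 := h1.trans (hh.sumNorm_le (a := (ω, ξ)) (t := 0) (hb ξ τ))
    rw [expWeight_zero, one_mul] at h2
    have h3 : 0 ≤ M τ := hh.nonneg 0 τ
    refine div_le_of_le_mul₀ (norm_nonneg _) (mul_nonneg hCnn h3) (h2.trans_eq (by ring))
  have hGlim : ∀ τ, Tendsto (fun ξ => ‖G ξ τ‖ / ‖ξ‖) (𝓝 0) (𝓝 0) := fun τ => by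
    have hO : (fun ξ => (X ξ τ, Y ξ τ)) =O[𝓝 0] (id : E n → E n) :=
      Asymptotics.IsBigO.of_bound (C * expWeight θ z ε η ω τ) (Eventually.of_forall fun ξ =>
        (norm_le_sumNorm _).trans ((hb ξ τ).trans_eq (by rw [id]; ring)))
    have ht : Tendsto (fun ξ => (X ξ τ, Y ξ τ)) (𝓝 0) (𝓝 0) := hO.trans_tendsto tendsto_id
    have ho : (fun ξ => rescale fs (ε * z (θ τ ω)) (X ξ τ, Y ξ τ)) =o[𝓝 0] (id : E n → E n) :=
      ((rescale_isLittleO hfs hS.stable_zero (ε * z (θ τ ω))).comp_tendsto ht).trans_isBigO hO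
    have hoG : (fun ξ => G ξ τ) =o[𝓝 0] (id : E n → E n) := by
      by_cases hτ : τ ∈ Iic (0 : ℝ)
      · simp only [hG, lyapunovPerronKernel, indicator_of_mem hτ]
        exact ((propagator θ z ε As ω τ 0).isBigO_comp _ _).trans_isLittleO ho
      · simp only [hG, lyapunovPerronKernel, indicator_of_notMem hτ]
        exact Asymptotics.isLittleO_zero _ _
    exact hoG.norm_norm.tendsto_div_nhds_zero
  have hint : Tendsto (fun ξ => ∫ τ, ‖G ξ τ‖ / ‖ξ‖) (𝓝 0) (𝓝 0) := by
    have := tendsto_integral_filter_of_dominated_convergence (μ := volume) (l := 𝓝 (0 : E n))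
      (F := fun ξ τ => ‖G ξ τ‖ / ‖ξ‖) (f := fun _ => (0 : ℝ)) (fun τ => C * M τ)
      (Eventually.of_forall fun ξ => ((hGm ξ).norm.div_const _).aestronglyMeasurable)
      (Eventually.of_forall fun ξ => ae_of_all _ fun τ => by
        rw [Real.norm_of_nonneg (by positivity)]; exact hGb ξ τ)
      ((hh.integrable 0).const_mul C) (ae_of_all _ hGlim)
    simpa using this
  have hY : ∀ ξ, ‖Y ξ 0‖ / ‖ξ‖ ≤ ∫ τ, ‖G ξ τ‖ / ‖ξ‖ := fun ξ => by
    have e : Y ξ 0 = ∫ τ, G ξ τ := by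
      rw [(h ξ).eqY 0, ← integral_indicator measurableSet_Iic]
      rfl
    rw [integral_div, e]
    gcongr
    exact norm_integral_le_integral_norm _
  have hY0 : Y 0 0 = 0 := by
    have := (norm_snd_le (X 0 0, Y 0 0)).trans ((norm_le_sumNorm _).trans (hb 0 0))
    simpa using this
  rw [hasFDerivAt_iff_tendsto]
  refine squeeze_zero (fun ξ => by positivity) (fun ξ => ?_) hint
  simpa [hY0, div_eq_inv_mul] using hY ξ

theorem exists_centerManifold (hS : IsGapSystem θ z η Ac As fc fs L β γ K)
    {φ : ℝ → Ω → E n × E m → E n × E m} (hφ : IsSolutionMap (field θ z ε Ac As fc fs) φ) :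
    ∃ H : Ω → E n → E m,
      IsLipschitzCenterManifold θ φ H ∧
      (∀ ω ξ, ∃! p : (ℝ → E n) × (ℝ → E m),
        IsLyapunovPerronSolution θ z ε η Ac As fc fs ω ξ p.1 p.2) ∧
      (∀ ω ξ X Y, IsLyapunovPerronSolution θ z ε η Ac As fc fs ω ξ X Y → H ω ξ = Y 0) ∧
      (HasFDerivAt fs (0 : E n × E m →L[ℝ] E m) 0 →
        ∀ ω, HasFDerivAt (H ω) (0 : E n →L[ℝ] E m) 0) := by
  obtain ⟨u, hum, hu⟩ := hS.exists_isLyapunovPerronSolution ε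
  have huniq : ∀ ω ξ X Y, IsLyapunovPerronSolution θ z ε η Ac As fc fs ω ξ X Y →
      (u (ω, ξ) 0).2 = Y 0 := fun ω ξ X Y h =>
    congrFun (hS.isLyapunovPerronSolution_unique (hu ω ξ) h).2 0
  set C := K / (1 - (K * L / (η - γ) + K * L / (β - η))) with hC
  have hCnn : 0 ≤ C := div_nonneg hS.const_pos.le (sub_nonneg.2 hS.gap.le)
  have hlip : ∀ ω, LipschitzWith (Real.toNNReal C) fun ξ => (u (ω, ξ) 0).2 := fun ω =>
    LipschitzWith.of_dist_le_mul fun ξ ξ' => by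
      rw [dist_eq_norm, dist_eq_norm, Real.coe_toNNReal _ hCnn]
      have h1 := hS.isLyapunovPerronSolution_sub_le (hu ω ξ) (hu ω ξ') 0
      rw [expWeight_zero, mul_one] at h1
      refine (le_add_of_nonneg_left (norm_nonneg _)).trans (h1.trans_eq ?_)
      rw [hC, mul_div_right_comm]
  have hmeas : ∀ ξ, Measurable fun ω => (u (ω, ξ) 0).2 := fun ξ =>
    (hum.comp ((measurable_id.prodMk measurable_const).prodMk measurable_const)).snd
  refine ⟨fun ω ξ => (u (ω, ξ) 0).2, ⟨?_, ?_, ?_, hmeas, fun ω => ⟨_, hlip ω⟩⟩, ?_, huniq, ?_⟩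
  · exact isRandomSet_graph hmeas fun ω => (hlip ω).continuous
  · rintro t ω _ ⟨⟨ξ, y⟩, hy, rfl⟩
    obtain rfl : y = (u (ω, ξ) 0).2 := hy
    have hz := hS.continuous_path ω
    -- The orbit of `φ` through `(ξ, H ω ξ)` is the Lyapunov–Perron solution; its shift by `t` shows
    -- that the value at time `t` lies on the graph over `θ t ω`.
    have h1 := (hφ ω _).1 (fun s => (hu ω ξ).hasDerivAt hz hS.continuous_center
      hS.continuous_stable s) t
    rw [(hu ω ξ).center_zero] at h1
    rw [← h1]
    have h2 := huniq _ _ _ _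
      ((hu ω ξ).shift hS.flow_add hz hS.continuous_center hS.weight_nonneg t)
    simp only [zero_add] at h2
    exact h2.symm
  · exact fun ω => huniq _ _ _ _ (hS.isLyapunovPerronSolution_zero ω)
  · refine fun ω ξ => ⟨(_, _), hu ω ξ, fun p hp => ?_⟩
    obtain ⟨h1, h2⟩ := hS.isLyapunovPerronSolution_unique hp (hu ω ξ)
    exact Prod.ext h1 h2
  · exact fun hfs ω => hS.hasFDerivAt_zero hfs (hu ω)

end IsGapSystem

end CenterManifold

end RandomCenterManifold

end

/-! ### The theorem for the Ornstein–Uhlenbeck variable -/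

open RandomCenterManifold in
theorem mainTheorem2 {Ω : Type*} [MeasurableSpace Ω] (P : Measure Ω) [IsProbabilityMeasure P]
    (θ : ℝ → Ω → Ω) (hθ : IsErgodicFlow P θ)
    (W : ℝ → Ω → ℝ) (hW : IsTwoSidedWiener P θ W)
    (n m : ℕ) (Ac : E n →L[ℝ] E n) (As : E m →L[ℝ] E m)
    (fc : E n × E m → E n) (fs : E n × E m → E m)
    (hfc : ContDiff ℝ 1 fc) (hfs : ContDiff ℝ 1 fs) (hfc0 : fc 0 = 0) (hfs0 : fs 0 = 0)
    (L : ℝ) (hL : 0 ≤ L)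
    (hfcL : ∀ x₁ x₂ y₁ y₂, ‖fc (x₁, y₁) - fc (x₂, y₂)‖ ≤ L * (‖x₁ - x₂‖ + ‖y₁ - y₂‖))
    (hfsL : ∀ x₁ x₂ y₁ y₂, ‖fs (x₁, y₁) - fs (x₂, y₂)‖ ≤ L * (‖x₁ - x₂‖ + ‖y₁ - y₂‖))
    (β γ K : ℝ) (hγ : 0 ≤ γ) (hγβ : γ < β) (hK : 0 < K)
    (hAc : ∀ (t : ℝ) (x : E n), ‖NormedSpace.exp (t • Ac) x‖ ≤ K * Real.exp (γ * |t|) * ‖x‖)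
    (hAs : ∀ t : ℝ, 0 ≤ t → ∀ y : E m,
      ‖NormedSpace.exp (t • As) y‖ ≤ K * Real.exp (-β * t) * ‖y‖)
    (ε : ℝ) (hε : 0 < ε)
    (η : ℝ) (hγη : γ < η) (hηβ : η < β) (hgap : K * L / (η - γ) + K * L / (β - η) < 1) :
    ∃ φ : ℝ → Ω → E n × E m → E n × E m,
      IsRDS θ φ ∧ IsSolutionMap (field θ (ouVar W) ε Ac As fc fs) φ ∧
      ∃ H : Ω → E n → E m,
        IsLipschitzCenterManifold θ φ H ∧
        (∀ ω ξ, ∃! p : (ℝ → E n) × (ℝ → E m),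
          IsLyapunovPerronSolution θ (ouVar W) ε η Ac As fc fs ω ξ p.1 p.2) ∧
        (∀ ω ξ X Y, IsLyapunovPerronSolution θ (ouVar W) ε η Ac As fc fs ω ξ X Y →
          H ω ξ = Y 0) ∧
        (fderiv ℝ fs 0 = 0 → ∀ ω, HasFDerivAt (H ω) (0 : E n →L[ℝ] E m) 0) := by
  have hz := measurable_ouVar hW
  have hzc := continuous_ouVar_flow hW
  obtain ⟨φ, hφ, hsol⟩ := exists_solutionMap (ε := ε) (Ac := Ac) (As := As) hθ.measurable
    hθ.map_add hz hzc hfc.continuous hfs.continuous hfc0 hfs0 hL hfcL hfsL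
  have hS : IsGapSystem θ (ouVar W) η Ac As fc fs L β γ K :=
    ⟨hθ.measurable, hθ.map_add, hz, hzc, hfc.continuous, hfs.continuous, hfc0, hfs0, hL, hfcL,
      hfsL, hγ, hK, hAc, hAs, hγη, hηβ, hgap⟩
  obtain ⟨H, hH, huniq, hval, htan⟩ := hS.exists_centerManifold hsol
  refine ⟨φ, hφ, hsol, H, hH, huniq, hval, fun hD => htan ?_⟩
  rw [← hD]
  exact (hfs.differentiable one_ne_zero).differentiableAt.hasFDerivAt
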